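/- Throughout, $\lfloor x\rfloor$ and $\{x\}=x-\lfloor x\rfloor$ are the integer and fractional parts of $x\in\mathbb R$, and for $c\in\mathbb R$ the step function $\theta_c$ is given by $\theta_c(z)=0$ if $z<c$ and $\theta_c(z)=1$ if $z\ge c$. Let $\lambda\in(0,1)$, $d\in(0,1-\lambda)$, $\delta\in(1-\lambda-d,1)$, $a\in[0,1]$, $\rho\in(0,1)$ and $\alpha\in[0,1]$. Let $$f(x)=\{F(x)\},\qquad F(x)=\lambda x+\delta+(1-\lambda)\lfloor x\rfloor+d\,\theta_a(\{x\}),$$ so that $f$ maps $[0,1)$ into itself, and let $R_\rho:[0,1)\to[0,1)$, $R_\rho(y)=\{y+\rho\}$. For $r,\beta\in[0,1]$ and $y\in\mathbb R$ put $$\delta(r,\beta)=1-\lambda-d+\frac{1-\lambda}{\lambda}\sum_{k=1}^\infty\lambda^k\bigl((1-\lambda)\lfloor kr\rfloor+d\,\theta_{1-\beta}(\{kr\})\bigr),$$ $$a(\delta,r,\beta)=\frac{\delta}{1-\lambda}+\frac1\lambda\sum_{k=1}^\infty\lambda^k\bigl((1-\lambda)\lfloor \beta-kr\rfloor+d\,\theta_{\beta}(\{\beta-kr\})\bigr),$$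 $$\phi(y)=\phi_{\delta,\rho,\alpha}(y)=\frac{\delta}{1-\lambda}+\frac1\lambda\sum_{k=1}^\infty\lambda^k\bigl((1-\lambda)\lfloor y-k\rho\rfloor+d\,\theta_{\alpha}(\{y-k\rho\})\bigr),$$ and let $\delta(\rho^-,\alpha)=\lim_{r\to\rho^-}\delta(r,\alpha)$ and $a(\delta,\rho^+,\alpha)=\lim_{r\to\rho^+}a(\delta,r,\alpha)$, limits which exist. Let $\eta_1=(1-\delta-d)/\lambda$ and $\eta_2=(1-\delta)/\lambda$. Since $\eta_1<1$, $\eta_2>0$ and $\eta_1<\eta_2$, exactly one of the following holds: $(M_1)$ $a<\eta_1$; $(M_2)$ $\eta_1\le a\le\eta_2$; $(M_3)$ $a>\eta_2$. Then the following three statements are equivalent: 1. $\delta\in[\delta(\rho^-,\alpha),\delta(\rho,\alpha)]$ and $a\in[a(\delta,\rho^+,\alpha),a(\delta,\rho,\alpha)]$, with moreover $\delta\ne\delta(\rho,\alpha)$ and $a\ne a(\delta,\rho^+,\alpha)$ if $\rho\in\mathbb Q$. 2. $\phi([0,1))\subset[0,1)$ and $f(\phi(y))=\phi(R_\rho(y))$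 for every $y\in[0,1)$. 3. For every $y\in[0,1)$ and every $n\ge 0$, $$\theta_a(f^n(\phi(y)))=\theta_\alpha(R_\rho^n(y))\quad\text{and}\quad\theta_\eta(f^n(\phi(y)))=\theta_{1-\rho}(R_\rho^n(y)),$$ where $\alpha\in[0,1-\rho]$ and $\eta=\eta_1$ in case $(M_1)$, $\alpha=1-\rho$ and $\eta=a$ in case $(M_2)$, and $\alpha\in[1-\rho,1]$ and $\eta=\eta_2$ in case $(M_3)$ (the condition on $\alpha$ being part of the statement). If one of these statements holds, then $\phi([0,1))\subset\Lambda:=\bigcap_{n\ge 0}f^n([0,1))$. Moreover, in that case: - if $\rho=p/q$ with $0<p<q$ coprime integers and $\alpha\in\{0,\tfrac1q,\dots,\tfrac{q-1}q,1\}$, then $\phi([0,1))$ is a periodic orbit of $f$ of least period $q$; - if $\rho=p/q$ with $0<p<q$ coprime integers and $\alpha\notin\{0,\tfrac1q,\dots,\tfrac{q-1}q,1\}$, then $f$ has exactly two periodic orbits of least period $q$ in $[0,1)$, and $\phi([0,1))=\Lambda$ is their union; - if $\rho$ is irrational, then $\phi([0,1))=\Lambda$ and the closure $\overline\Lambda$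 is a Cantor set (a non-empty compact, totally disconnected set without isolated points). -/

import Mathlib

open Set Filter Topology

noncomputable section

/-- The step function `θ_a`: `0` on `(-∞, a)` and `1` on `[a, ∞)`. -/
def stepTheta (a z : ℝ) : ℝ := if z < a then 0 else 1

/-- The lift `F(x) = λ x + δ + (1 - λ) ⌊x⌋ + d θ_a({x})`. -/
def liftMap (lam d δ a x : ℝ) : ℝ :=
  lam * x + δ + (1 - lam) * (⌊x⌋ : ℝ) + d * stepTheta a (Int.fract x)

/-- The interval map `f_{δ,a}(x) = F(x) mod 1`. It is considered on `[0, 1)`, which it maps into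
itself; the formula makes sense for every real `x`. -/
def pcMap (lam d δ a x : ℝ) : ℝ := Int.fract (liftMap lam d δ a x)

/-- The rotation `R_ρ(y) = {y + ρ}` of angle `ρ`, considered on `[0, 1)`. -/
def rotMap (ρ y : ℝ) : ℝ := Int.fract (y + ρ)

/-- `η₁ = (1 - δ - d) / λ`. -/
def etaOne (lam d δ : ℝ) : ℝ := (1 - δ - d) / lam

/-- `η₂ = (1 - δ) / λ`. -/
def etaTwo (lam δ : ℝ) : ℝ := (1 - δ) / lam

/-- The parameter region `M₁`. -/
def regionOne (lam d : ℝ) : Set (ℝ × ℝ) :=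
  {z | z.1 ∈ Ioo (1 - lam - d) (1 - d) ∧ z.2 ∈ Ico 0 (etaOne lam d z.1)}

/-- The parameter region `M₂`. -/
def regionTwo (lam d : ℝ) : Set (ℝ × ℝ) :=
  {z | z.1 ∈ Ioo (1 - lam - d) 1 ∧ z.2 ∈ Icc 0 1 ∩ Icc (etaOne lam d z.1) (etaTwo lam z.1)}

/-- The parameter region `M₃`. -/
def regionThree (lam : ℝ) : Set (ℝ × ℝ) :=
  {z | z.1 ∈ Ioo (1 - lam) 1 ∧ z.2 ∈ Ioc (etaTwo lam z.1) 1}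

/-- The function `δ(ρ, α)`; the sum over `k ≥ 1` is written with the index `k + 1`, `k ≥ 0`. -/
def deltaFun (lam d ρ α : ℝ) : ℝ :=
  1 - lam - d + (1 - lam) / lam *
    ∑' k : ℕ, lam ^ (k + 1) * ((1 - lam) * (⌊((k + 1 : ℕ) : ℝ) * ρ⌋ : ℝ)
      + d * stepTheta (1 - α) (Int.fract (((k + 1 : ℕ) : ℝ) * ρ)))

/-- The function `a(δ, ρ, α)`. -/
def aFun (lam d δ ρ α : ℝ) : ℝ :=
  δ / (1 - lam) + 1 / lam *
    ∑' k : ℕ, lam ^ (k + 1) * ((1 - lam) * (⌊α - ((k + 1 : ℕ) : ℝ) * ρ⌋ : ℝ)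
      + d * stepTheta α (Int.fract (α - ((k + 1 : ℕ) : ℝ) * ρ)))

/-- `ψ_α(z) = (1 - λ) ⌊z⌋ + d θ_α({z})`. -/
def psiFun (lam d α z : ℝ) : ℝ := (1 - lam) * (⌊z⌋ : ℝ) + d * stepTheta α (Int.fract z)

/-- `φ_{δ,ρ,α}(y) = δ / (1 - λ) + (1 / λ) ∑_{k ≥ 1} λ ^ k ψ_α(y - k ρ)`. -/
def phiFun (lam d δ ρ α y : ℝ) : ℝ :=
  δ / (1 - lam) + 1 / lam * ∑' k : ℕ, lam ^ (k + 1) * psiFun lam d α (y - ((k + 1 : ℕ) : ℝ) * ρ)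

/-- The interval conditions: `δ ∈ [δ(ρ⁻, α), δ(ρ, α)]` and `a ∈ [a(δ, ρ⁺, α), a(δ, ρ, α)]`, where
`dl = δ(ρ⁻, α)` and `ar = a(δ, ρ⁺, α)` are the one-sided limits in the variable `ρ` (their existence
is part of the assertion), with `δ ≠ δ(ρ, α)` and `a ≠ a(δ, ρ⁺, α)` when `ρ` is rational. -/
def IntervalConditions (lam d δ a ρ α : ℝ) : Prop :=
  ∃ dl ar : ℝ,
    Tendsto (fun r => deltaFun lam d r α) (𝓝[<] ρ) (𝓝 dl) ∧
    Tendsto (fun r => aFun lam d δ r α) (𝓝[>] ρ) (𝓝 ar) ∧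
    δ ∈ Icc dl (deltaFun lam d ρ α) ∧
    a ∈ Icc ar (aFun lam d δ ρ α) ∧
    (¬ Irrational ρ → δ ≠ deltaFun lam d ρ α ∧ a ≠ ar)

/-- `φ([0,1)) ⊆ [0,1)` and `f ∘ φ = φ ∘ R_ρ` on `[0,1)`. -/
def ConjugacyCondition (lam d δ a ρ α : ℝ) : Prop :=
  phiFun lam d δ ρ α '' Ico 0 1 ⊆ Ico 0 1 ∧
    ∀ y ∈ Ico (0 : ℝ) 1,
      pcMap lam d δ a (phiFun lam d δ ρ α y) = phiFun lam d δ ρ α (rotMap ρ y)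

/-- Equality of codes: for every `y ∈ [0,1)`, the `f`-orbit of `φ(y)` has, relative to `a` and `η`,
the same code as the `R_ρ`-orbit of `y` relative to `α` and `1 - ρ`. -/
def SameCodes (lam d δ a ρ α η : ℝ) : Prop :=
  ∀ y ∈ Ico (0 : ℝ) 1, ∀ n : ℕ,
    stepTheta a ((pcMap lam d δ a)^[n] (phiFun lam d δ ρ α y)) =
      stepTheta α ((rotMap ρ)^[n] y) ∧
    stepTheta η ((pcMap lam d δ a)^[n] (phiFun lam d δ ρ α y)) =
      stepTheta (1 - ρ) ((rotMap ρ)^[n] y)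

/-- The coding condition, according to the region `M₁`, `M₂` or `M₃` (these regions partition the
parameter set) that contains `(δ, a)`. -/
def CodingCondition (lam d δ a ρ α : ℝ) : Prop :=
  ((δ, a) ∈ regionOne lam d ∧ α ∈ Icc 0 (1 - ρ) ∧
    SameCodes lam d δ a ρ α (etaOne lam d δ)) ∨
  ((δ, a) ∈ regionTwo lam d ∧ α = 1 - ρ ∧
    SameCodes lam d δ a ρ α a) ∨
  ((δ, a) ∈ regionThree lam ∧ α ∈ Icc (1 - ρ) 1 ∧
    SameCodes lam d δ a ρ α (etaTwo lam δ))

/-- The attractor `Λ = ⋂ₙ fⁿ([0,1))`. -/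
def attractor (lam d δ a : ℝ) : Set ℝ := ⋂ n : ℕ, (pcMap lam d δ a)^[n] '' Ico 0 1

/-- `P` is a `q`-periodic orbit in `[0,1)` of the map `g`: the orbit of a point of least period
`q ≥ 1`. -/
def IsPeriodicOrbit (g : ℝ → ℝ) (q : ℕ) (P : Set ℝ) : Prop :=
  0 < q ∧ ∃ x ∈ Ico (0 : ℝ) 1, Function.minimalPeriod g x = q ∧ P = range (fun n : ℕ => g^[n] x)

/-- A Cantor set: a non-empty, compact, totally disconnected set that is perfect, i.e. closed and
without isolated points. -/
def IsCantorSet (S : Set ℝ) : Prop :=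
  S.Nonempty ∧ IsCompact S ∧ Perfect S ∧ IsTotallyDisconnected S

end

variable {lam d δ a ρ α : ℝ}

/-! Write ψ for `psiFun`, φ for `phiFun` and F for the lift `liftMap`. The step function at a
fractional part is a difference of floors, so ψ_α(z) is, up to a constant, a combination of ⌊z⌋ and
⌊z - α⌋ with positive weights. Hence φ is nondecreasing and right continuous, commutes with integer
translations, and solves φ(y + ρ) = λ φ(y) + δ + ψ_α(y). Since F(x) = λ x + δ + ψ_a(x), the identity
F(φ(y)) = φ(y + ρ) holds as soon as φ preserves the symbols: φ(y) ≥ 0 iff y ≥ 0, and φ(y) ≥ a iff y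
≥ α. This is `IsCompatible`, and each of the three statements is shown equivalent to it.

Intervals: compatibility is a pair of conditions on φ at and to the left of 0 and α, and the
interval ends are affine expressions in the values and left limits of φ there. Ends are excluded
only for rational ρ, where φ is locally constant on the left and attains its left limit. Conjugacy:
a mismatch of symbols would make d or -d an integer. Codes: equal symbols make f contract the error
f^n(φ(y)) - φ(R^n y) by λ, which forces φ into [0,1]; the value 1 is excluded separately.

For Λ, a point has a backward orbit X under F, squeezed between φ to the left of y - nρ and φ at y -
nρ. Once the symbols of X are eventually those of a genuine φ-orbit, contraction identifies X 0 with
a value of φ. For irrational ρ only finitely many y - nρ meet a discontinuity of ψ_α. For ρ = p/q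
with qα not an integer, these meetings lie in one class mod q, and monotonicity makes the choice of
side eventually constant. Jumps of φ separate its values for rational ρ, and are dense for
irrational ρ, whence the Cantor set. -/

theorem stepTheta_of_lt {c z : ℝ} (h : z < c) : stepTheta c z = 0 := if_pos h

theorem stepTheta_of_le {c z : ℝ} (h : c ≤ z) : stepTheta c z = 1 := if_neg h.not_gt

theorem stepTheta_eq_stepTheta_iff {c c' z z' : ℝ} :
    stepTheta c z = stepTheta c' z' ↔ (c ≤ z ↔ c' ≤ z') := by
  rcases lt_or_ge z c with h | h <;> rcases lt_or_ge z' c' with h' | h' <;>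
    simp [stepTheta_of_lt, stepTheta_of_le, h, h', not_le.2]

/-- On fractional parts the step function is a difference of floors. -/
theorem stepTheta_fract (hα : α ∈ Icc (0 : ℝ) 1) (z : ℝ) :
    stepTheta α (Int.fract z) = (⌊z - α⌋ : ℝ) - ⌊z⌋ + 1 := by
  have h0 := Int.fract_nonneg z
  have h1 := Int.fract_lt_one z
  have hz := Int.floor_add_fract z
  rcases lt_or_ge (Int.fract z) α with h | h
  · rw [stepTheta_of_lt h]
    have : ⌊z - α⌋ = ⌊z⌋ - 1 := by
      rw [Int.floor_eq_iff]; push_cast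
      constructor <;> linarith [hα.1, hα.2]
    rw [this]; push_cast; ring
  · rw [stepTheta_of_le h]
    have : ⌊z - α⌋ = ⌊z⌋ := by
      rw [Int.floor_eq_iff]
      constructor <;> linarith [hα.1, hα.2]
    rw [this]; ring

/-- Both weights `1 - lam - d` and `d` are positive, so monotonicity and one-sided limits can be
read off from the floors. -/
theorem psiFun_eq (hα : α ∈ Icc (0 : ℝ) 1) (z : ℝ) :
    psiFun lam d α z = (1 - lam - d) * ⌊z⌋ + d * ⌊z - α⌋ + d := by
  rw [psiFun, stepTheta_fract hα]; ring

/-- The left limit of `psiFun`. -/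
noncomputable def psiLeft (lam d α z : ℝ) : ℝ :=
  (1 - lam - d) * ((⌈z⌉ - 1 : ℤ) : ℝ) + d * ((⌈z - α⌉ - 1 : ℤ) : ℝ) + d

/-- The left limit of `phiFun`. -/
noncomputable def phiLeft (lam d δ ρ α y : ℝ) : ℝ :=
  δ / (1 - lam) + 1 / lam * ∑' k : ℕ, lam ^ (k + 1) * psiLeft lam d α (y - ((k + 1 : ℕ) : ℝ) * ρ)

/-! ### Growth bounds, summability and passage to the limit -/

theorem abs_floor_le (z : ℝ) : |(⌊z⌋ : ℝ)| ≤ |z| + 1 := by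
  have h1 := Int.floor_le z
  have h2 := Int.lt_floor_add_one z
  rw [abs_le]; constructor <;> cases abs_cases z <;> linarith

theorem abs_ceil_sub_one_le (z : ℝ) : |((⌈z⌉ - 1 : ℤ) : ℝ)| ≤ |z| + 1 := by
  have h1 := Int.le_ceil z
  have h2 := Int.ceil_lt_add_one z
  push_cast
  rw [abs_le]; constructor <;> cases abs_cases z <;> linarith

theorem abs_combination_le (hlam : lam ∈ Ioo (0 : ℝ) 1) (hd : d ∈ Ioo (0 : ℝ) (1 - lam))
    (hα : α ∈ Icc (0 : ℝ) 1) {z u v : ℝ} (hu : |u| ≤ |z| + 1) (hv : |v| ≤ |z - α| + 1) :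
    |(1 - lam - d) * u + d * v + d| ≤ |z| + 3 := by
  have hv' : |v| ≤ |z| + 2 := by
    have := abs_sub z α
    rw [abs_of_nonneg hα.1] at this
    linarith [hα.2]
  have h0 : 0 ≤ 1 - lam - d := by linarith [hd.2]
  have h1 := abs_add_le ((1 - lam - d) * u + d * v) d
  have h2 := abs_add_le ((1 - lam - d) * u) (d * v)
  rw [abs_mul, abs_mul, abs_of_nonneg h0, abs_of_nonneg hd.1.le] at h2
  rw [abs_of_nonneg hd.1.le] at h1
  have h3 := mul_le_mul_of_nonneg_left hu h0
  have h4 := mul_le_mul_of_nonneg_left hv' hd.1.le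
  nlinarith [abs_nonneg z, hlam.1, hlam.2, hd.1, hd.2, mul_nonneg hlam.1.le (abs_nonneg z)]

theorem abs_psiFun_le (hlam : lam ∈ Ioo (0 : ℝ) 1) (hd : d ∈ Ioo (0 : ℝ) (1 - lam))
    (hα : α ∈ Icc (0 : ℝ) 1) (z : ℝ) : |psiFun lam d α z| ≤ |z| + 3 := by
  rw [psiFun_eq hα]
  exact abs_combination_le hlam hd hα (abs_floor_le z) (abs_floor_le _)

theorem abs_psiLeft_le (hlam : lam ∈ Ioo (0 : ℝ) 1) (hd : d ∈ Ioo (0 : ℝ) (1 - lam))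
    (hα : α ∈ Icc (0 : ℝ) 1) (z : ℝ) : |psiLeft lam d α z| ≤ |z| + 3 :=
  abs_combination_le hlam hd hα (abs_ceil_sub_one_le z) (abs_ceil_sub_one_le _)

theorem abs_orbit_le {y r c C : ℝ} (hr : |r| ≤ c) (hy : |y| ≤ C) {s : ℝ} (k : ℕ)
    (hs : |s| ≤ |y - ((k + 1 : ℕ) : ℝ) * r| + 3) : |s| ≤ (C + c + 3) * ((k : ℝ) + 1) := by
  have h1 := abs_sub y (((k + 1 : ℕ) : ℝ) * r)
  rw [abs_mul, Nat.abs_cast] at h1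
  push_cast at h1
  have hk : (0 : ℝ) ≤ k := k.cast_nonneg
  have h2 := mul_le_mul_of_nonneg_left hr (by linarith : (0 : ℝ) ≤ k + 1)
  push_cast at hs
  nlinarith [abs_nonneg y]

theorem summable_pow_mul_linear (hlam : lam ∈ Ioo (0 : ℝ) 1) (C : ℝ) :
    Summable fun k : ℕ => lam ^ (k + 1) * (C * ((k : ℝ) + 1)) := by
  have h : ‖lam‖ < 1 := by rw [Real.norm_of_nonneg hlam.1.le]; exact hlam.2
  have h1 := summable_pow_mul_geometric_of_norm_lt_one 1 h
  have h2 := ((summable_nat_add_iff 1).2 h1).mul_left C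
  refine h2.congr fun k => ?_
  push_cast; ring

theorem summable_pow_mul_of_abs_le (hlam : lam ∈ Ioo (0 : ℝ) 1) {g : ℕ → ℝ} {C : ℝ}
    (hg : ∀ k, |g k| ≤ C * ((k : ℝ) + 1)) : Summable fun k : ℕ => lam ^ (k + 1) * g k := by
  refine Summable.of_norm_bounded (summable_pow_mul_linear hlam C) fun k => ?_
  rw [norm_mul, Real.norm_of_nonneg (pow_nonneg hlam.1.le _)]
  exact mul_le_mul_of_nonneg_left (hg k) (pow_nonneg hlam.1.le _)

/-- Dominated convergence for terms that are eventually constant. It serves for one-sided limits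
both in the point and in the rotation number. -/
theorem tendsto_tsum_pow_mul {ι : Type*} {l : Filter ι} (hlam : lam ∈ Ioo (0 : ℝ) 1)
    {g : ι → ℕ → ℝ} {h : ℕ → ℝ} {C : ℝ} (hb : ∀ᶠ i in l, ∀ k, |g i k| ≤ C * ((k : ℝ) + 1))
    (he : ∀ k, ∀ᶠ i in l, g i k = h k) :
    Tendsto (fun i => ∑' k : ℕ, lam ^ (k + 1) * g i k) l (𝓝 (∑' k : ℕ, lam ^ (k + 1) * h k)) := by
  refine tendsto_tsum_of_dominated_convergence (summable_pow_mul_linear hlam C) (fun k => ?_) ?_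
  · refine tendsto_const_nhds.congr' ?_
    filter_upwards [he k] with i hi
    rw [hi]
  · filter_upwards [hb] with i hi k
    rw [norm_mul, Real.norm_of_nonneg (pow_nonneg hlam.1.le _)]
    exact mul_le_mul_of_nonneg_left (hi k) (pow_nonneg hlam.1.le _)

theorem summable_psiFun (hlam : lam ∈ Ioo (0 : ℝ) 1) (hd : d ∈ Ioo (0 : ℝ) (1 - lam))
    (hα : α ∈ Icc (0 : ℝ) 1) (ρ y : ℝ) :
    Summable fun k : ℕ => lam ^ (k + 1) * psiFun lam d α (y - ((k + 1 : ℕ) : ℝ) * ρ) :=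
  summable_pow_mul_of_abs_le hlam fun k =>
    abs_orbit_le le_rfl le_rfl k (abs_psiFun_le hlam hd hα _)

theorem summable_psiLeft (hlam : lam ∈ Ioo (0 : ℝ) 1) (hd : d ∈ Ioo (0 : ℝ) (1 - lam))
    (hα : α ∈ Icc (0 : ℝ) 1) (ρ y : ℝ) :
    Summable fun k : ℕ => lam ^ (k + 1) * psiLeft lam d α (y - ((k + 1 : ℕ) : ℝ) * ρ) :=
  summable_pow_mul_of_abs_le hlam fun k =>
    abs_orbit_le le_rfl le_rfl k (abs_psiLeft_le hlam hd hα _)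

theorem tsum_pow_succ (hlam : lam ∈ Ioo (0 : ℝ) 1) :
    ∑' k : ℕ, lam ^ (k + 1) = lam / (1 - lam) := by
  simp_rw [pow_succ]
  rw [tsum_mul_right, tsum_geometric_of_lt_one hlam.1.le hlam.2]
  field_simp

/-! ### The functions `psiFun` and `psiLeft` -/

theorem psiFun_mono (hd : d ∈ Ioo (0 : ℝ) (1 - lam)) (hα : α ∈ Icc (0 : ℝ) 1) :
    Monotone (psiFun lam d α) := by
  intro z w h
  rw [psiFun_eq hα, psiFun_eq hα]
  have h1 : (⌊z⌋ : ℝ) ≤ ⌊w⌋ := by exact_mod_cast Int.floor_mono h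
  have h2 : (⌊z - α⌋ : ℝ) ≤ ⌊w - α⌋ := by exact_mod_cast Int.floor_mono (by linarith)
  have h3 := mul_le_mul_of_nonneg_left h1 (by linarith [hd.2] : 0 ≤ 1 - lam - d)
  have h4 := mul_le_mul_of_nonneg_left h2 hd.1.le
  linarith

theorem psiFun_add_int (z : ℝ) (m : ℤ) :
    psiFun lam d α (z + m) = psiFun lam d α z + (1 - lam) * m := by
  simp only [psiFun, Int.floor_add_intCast, Int.fract_add_intCast]
  push_cast; ring

theorem ceil_sub_one_le_floor (z : ℝ) : ⌈z⌉ - 1 ≤ ⌊z⌋ := by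
  have := Int.ceil_le_floor_add_one z
  omega

theorem floor_le_ceil_sub_one {z w : ℝ} (h : z < w) : ⌊z⌋ ≤ ⌈w⌉ - 1 := by
  have : ⌊z⌋ < ⌈w⌉ := Int.lt_ceil.2 ((Int.floor_le z).trans_lt h)
  omega

theorem psiLeft_le_psiFun (hd : d ∈ Ioo (0 : ℝ) (1 - lam)) (hα : α ∈ Icc (0 : ℝ) 1) (z : ℝ) :
    psiLeft lam d α z ≤ psiFun lam d α z := by
  rw [psiFun_eq hα, psiLeft]
  have h1 : ((⌈z⌉ - 1 : ℤ) : ℝ) ≤ ⌊z⌋ := by exact_mod_cast ceil_sub_one_le_floor z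
  have h2 : ((⌈z - α⌉ - 1 : ℤ) : ℝ) ≤ ⌊z - α⌋ := by exact_mod_cast ceil_sub_one_le_floor (z - α)
  have h3 := mul_le_mul_of_nonneg_left h1 (by linarith [hd.2] : 0 ≤ 1 - lam - d)
  have h4 := mul_le_mul_of_nonneg_left h2 hd.1.le
  linarith

theorem psiLeft_lt_psiFun (hd : d ∈ Ioo (0 : ℝ) (1 - lam)) (hα : α ∈ Icc (0 : ℝ) 1) {z : ℝ}
    (h : ∃ m : ℤ, z = m ∨ z = α + m) : psiLeft lam d α z < psiFun lam d α z := by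
  rw [psiFun_eq hα, psiLeft]
  have h1 : ((⌈z⌉ - 1 : ℤ) : ℝ) ≤ ⌊z⌋ := by exact_mod_cast ceil_sub_one_le_floor z
  have h2 : ((⌈z - α⌉ - 1 : ℤ) : ℝ) ≤ ⌊z - α⌋ := by exact_mod_cast ceil_sub_one_le_floor (z - α)
  have h3 := mul_le_mul_of_nonneg_left h1 (by linarith [hd.2] : 0 ≤ 1 - lam - d)
  have h4 := mul_le_mul_of_nonneg_left h2 hd.1.le
  obtain ⟨m, rfl | rfl⟩ := h
  · simp only [Int.ceil_intCast, Int.floor_intCast] at *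
    push_cast at *
    nlinarith [hd.2]
  · simp only [add_sub_cancel_left, Int.ceil_intCast, Int.floor_intCast] at *
    push_cast at *
    nlinarith [hd.1]

theorem psiFun_le_psiLeft (hd : d ∈ Ioo (0 : ℝ) (1 - lam)) (hα : α ∈ Icc (0 : ℝ) 1) {z w : ℝ}
    (h : z < w) : psiFun lam d α z ≤ psiLeft lam d α w := by
  rw [psiFun_eq hα, psiLeft]
  have h1 : (⌊z⌋ : ℝ) ≤ ((⌈w⌉ - 1 : ℤ) : ℝ) := by exact_mod_cast floor_le_ceil_sub_one h
  have h2 : (⌊z - α⌋ : ℝ) ≤ ((⌈w - α⌉ - 1 : ℤ) : ℝ) := by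
    exact_mod_cast floor_le_ceil_sub_one (by linarith : z - α < w - α)
  have h3 := mul_le_mul_of_nonneg_left h1 (by linarith [hd.2] : 0 ≤ 1 - lam - d)
  have h4 := mul_le_mul_of_nonneg_left h2 hd.1.le
  linarith

theorem tendsto_sub_const_nhdsLT (y c : ℝ) : Tendsto (fun z => z - c) (𝓝[<] y) (𝓝[<] (y - c)) :=
  tendsto_nhdsWithin_of_tendsto_nhds_of_eventually_within _
    (((continuous_id.sub continuous_const).tendsto y).mono_left nhdsWithin_le_nhds)
    (by filter_upwards [self_mem_nhdsWithin] with z hz; exact sub_lt_sub_right hz c)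

theorem tendsto_sub_const_nhdsGE (y c : ℝ) : Tendsto (fun z => z - c) (𝓝[≥] y) (𝓝[≥] (y - c)) :=
  tendsto_nhdsWithin_of_tendsto_nhds_of_eventually_within _
    (((continuous_id.sub continuous_const).tendsto y).mono_left nhdsWithin_le_nhds)
    (by filter_upwards [self_mem_nhdsWithin] with z hz; exact sub_le_sub_right hz c)

theorem tendsto_sub_const_nhdsGT (y c : ℝ) : Tendsto (fun z => z - c) (𝓝[>] y) (𝓝[>] (y - c)) :=
  tendsto_nhdsWithin_of_tendsto_nhds_of_eventually_within _
    (((continuous_id.sub continuous_const).tendsto y).mono_left nhdsWithin_le_nhds)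
    (by filter_upwards [self_mem_nhdsWithin] with z hz; exact sub_lt_sub_right hz c)

theorem eventually_floor_left (α w : ℝ) :
    ∀ᶠ z in 𝓝[<] w, ⌊z⌋ = ⌈w⌉ - 1 ∧ ⌊z - α⌋ = ⌈w - α⌉ - 1 := by
  have h := tendsto_sub_const_nhdsLT w α
  exact (tendsto_pure.1 (tendsto_floor_left_pure_ceil_sub_one w)).and
    (h.eventually (tendsto_pure.1 (tendsto_floor_left_pure_ceil_sub_one (w - α))))

theorem eventually_floor_right (α w : ℝ) :
    ∀ᶠ z in 𝓝[≥] w, ⌊z⌋ = ⌊w⌋ ∧ ⌊z - α⌋ = ⌊w - α⌋ := by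
  have h := tendsto_sub_const_nhdsGE w α
  exact (tendsto_pure.1 (tendsto_floor_right_pure_floor w)).and
    (h.eventually (tendsto_pure.1 (tendsto_floor_right_pure_floor (w - α))))

theorem eventually_ceil_right (α w : ℝ) :
    ∀ᶠ z in 𝓝[>] w, ⌈z⌉ = ⌊w⌋ + 1 ∧ ⌈z - α⌉ = ⌊w - α⌋ + 1 := by
  have h := tendsto_sub_const_nhdsGT w α
  exact (tendsto_pure.1 (tendsto_ceil_right_pure_floor_add_one w)).and
    (h.eventually (tendsto_pure.1 (tendsto_ceil_right_pure_floor_add_one (w - α))))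

theorem eventually_psiFun_eq_psiLeft (hα : α ∈ Icc (0 : ℝ) 1) (w : ℝ) :
    ∀ᶠ z in 𝓝[<] w, psiFun lam d α z = psiLeft lam d α w := by
  filter_upwards [eventually_floor_left α w] with z hz
  rw [psiFun_eq hα, psiLeft, hz.1, hz.2]

theorem eventually_psiFun_eq (hα : α ∈ Icc (0 : ℝ) 1) (w : ℝ) :
    ∀ᶠ z in 𝓝[≥] w, psiFun lam d α z = psiFun lam d α w := by
  filter_upwards [eventually_floor_right α w] with z hz
  rw [psiFun_eq hα, psiFun_eq hα, hz.1, hz.2]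

theorem eventually_psiLeft_eq_psiFun (hα : α ∈ Icc (0 : ℝ) 1) (w : ℝ) :
    ∀ᶠ z in 𝓝[>] w, psiLeft lam d α z = psiFun lam d α w := by
  filter_upwards [eventually_ceil_right α w] with z hz
  rw [psiFun_eq hα, psiLeft, hz.1, hz.2]
  simp

/-! ### The functions `phiFun` and `phiLeft` -/

/-- The term k = 1 of the series at `y + ρ` is ψ_α(y); the remaining terms are λ times the series at
`y`. -/
theorem phiFun_add (hlam : lam ∈ Ioo (0 : ℝ) 1) (hd : d ∈ Ioo (0 : ℝ) (1 - lam))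
    (hα : α ∈ Icc (0 : ℝ) 1) (y : ℝ) :
    phiFun lam d δ ρ α (y + ρ) = lam * phiFun lam d δ ρ α y + δ + psiFun lam d α y := by
  have h0 : lam ≠ 0 := hlam.1.ne'
  have h1 : 1 - lam ≠ 0 := by linarith [hlam.2]
  rw [phiFun, phiFun, (summable_psiFun hlam hd hα ρ (y + ρ)).tsum_eq_zero_add]
  have : ∀ k : ℕ, lam ^ (k + 1 + 1) * psiFun lam d α (y + ρ - ((k + 1 + 1 : ℕ) : ℝ) * ρ)
      = lam * (lam ^ (k + 1) * psiFun lam d α (y - ((k + 1 : ℕ) : ℝ) * ρ)) := by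
    intro k
    rw [show y + ρ - ((k + 1 + 1 : ℕ) : ℝ) * ρ = y - ((k + 1 : ℕ) : ℝ) * ρ by push_cast; ring]
    ring
  simp_rw [this]
  rw [tsum_mul_left]
  simp only [zero_add, pow_one, Nat.cast_one, one_mul, add_sub_cancel_right]
  generalize (∑' k : ℕ, lam ^ (k + 1) * psiFun lam d α (y - ((k + 1 : ℕ) : ℝ) * ρ)) = S
  field_simp
  ring

/-- The normalisation 1/λ · ∑ λ^k (1 - λ) = 1 makes φ a lift of degree one. -/
theorem phiFun_add_int (hlam : lam ∈ Ioo (0 : ℝ) 1) (hd : d ∈ Ioo (0 : ℝ) (1 - lam))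
    (hα : α ∈ Icc (0 : ℝ) 1) (y : ℝ) (m : ℤ) :
    phiFun lam d δ ρ α (y + m) = phiFun lam d δ ρ α y + m := by
  have h0 : lam ≠ 0 := hlam.1.ne'
  have h1 : 1 - lam ≠ 0 := by linarith [hlam.2]
  have hs : Summable fun k : ℕ => lam ^ (k + 1) := by
    simp_rw [pow_succ]
    exact (summable_geometric_of_lt_one hlam.1.le hlam.2).mul_right _
  rw [phiFun, phiFun]
  have : ∀ k : ℕ, lam ^ (k + 1) * psiFun lam d α (y + m - ((k + 1 : ℕ) : ℝ) * ρ)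
      = lam ^ (k + 1) * psiFun lam d α (y - ((k + 1 : ℕ) : ℝ) * ρ)
        + lam ^ (k + 1) * ((1 - lam) * m) := by
    intro k
    rw [show y + m - ((k + 1 : ℕ) : ℝ) * ρ = y - ((k + 1 : ℕ) : ℝ) * ρ + m by ring,
      psiFun_add_int]
    ring
  simp_rw [this]
  rw [(summable_psiFun hlam hd hα ρ y).tsum_add (hs.mul_right _), tsum_mul_right,
    tsum_pow_succ hlam]
  generalize (∑' k : ℕ, lam ^ (k + 1) * psiFun lam d α (y - ((k + 1 : ℕ) : ℝ) * ρ)) = S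
  field_simp
  ring

theorem phiFun_mono (hlam : lam ∈ Ioo (0 : ℝ) 1) (hd : d ∈ Ioo (0 : ℝ) (1 - lam))
    (hα : α ∈ Icc (0 : ℝ) 1) : Monotone (phiFun lam d δ ρ α) := by
  intro y z h
  rw [phiFun, phiFun]
  have := (summable_psiFun hlam hd hα ρ y).tsum_le_tsum (fun k =>
    mul_le_mul_of_nonneg_left (psiFun_mono hd hα (sub_le_sub_right h (((k + 1 : ℕ) : ℝ) * ρ)))
      (pow_nonneg hlam.1.le (k + 1))) (summable_psiFun hlam hd hα ρ z)
  have := mul_le_mul_of_nonneg_left this (by have := hlam.1; positivity : 0 ≤ 1 / lam)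
  linarith

theorem phiFun_le_phiLeft (hlam : lam ∈ Ioo (0 : ℝ) 1) (hd : d ∈ Ioo (0 : ℝ) (1 - lam))
    (hα : α ∈ Icc (0 : ℝ) 1) {y z : ℝ} (h : y < z) :
    phiFun lam d δ ρ α y ≤ phiLeft lam d δ ρ α z := by
  rw [phiFun, phiLeft]
  have := (summable_psiFun hlam hd hα ρ y).tsum_le_tsum (fun k =>
    mul_le_mul_of_nonneg_left (psiFun_le_psiLeft hd hα (sub_lt_sub_right h (((k + 1 : ℕ) : ℝ) * ρ)))
      (pow_nonneg hlam.1.le (k + 1))) (summable_psiLeft hlam hd hα ρ z)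
  have := mul_le_mul_of_nonneg_left this (by have := hlam.1; positivity : 0 ≤ 1 / lam)
  linarith

/-- `phiFun` jumps at the points `m + k ρ` and `α + m + k ρ`, `k ≥ 1`. -/
theorem phiLeft_lt_phiFun (hlam : lam ∈ Ioo (0 : ℝ) 1) (hd : d ∈ Ioo (0 : ℝ) (1 - lam))
    (hα : α ∈ Icc (0 : ℝ) 1) {y : ℝ}
    (h : ∃ (k : ℕ) (m : ℤ), 0 < k ∧ (y - k * ρ = m ∨ y - k * ρ = α + m)) :
    phiLeft lam d δ ρ α y < phiFun lam d δ ρ α y := by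
  obtain ⟨k, m, hk, hy⟩ := h
  obtain ⟨k, rfl⟩ := Nat.exists_eq_add_of_lt hk
  rw [zero_add] at hy
  rw [phiFun, phiLeft]
  have := (summable_psiLeft hlam hd hα ρ y).tsum_lt_tsum (i := k) (fun k =>
    mul_le_mul_of_nonneg_left (psiLeft_le_psiFun hd hα (y - ((k + 1 : ℕ) : ℝ) * ρ))
      (pow_nonneg hlam.1.le (k + 1)))
    (mul_lt_mul_of_pos_left (psiLeft_lt_psiFun hd hα ⟨m, hy⟩) (pow_pos hlam.1 (k + 1)))
    (summable_psiFun hlam hd hα ρ y)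
  have := mul_lt_mul_of_pos_left this (by have := hlam.1; positivity : 0 < 1 / lam)
  linarith

theorem phiFun_lt_phiFun (hlam : lam ∈ Ioo (0 : ℝ) 1) (hd : d ∈ Ioo (0 : ℝ) (1 - lam))
    (hα : α ∈ Icc (0 : ℝ) 1) {u v y : ℝ} (hu : u < y) (hv : y ≤ v)
    (h : ∃ (k : ℕ) (m : ℤ), 0 < k ∧ (y - k * ρ = m ∨ y - k * ρ = α + m)) :
    phiFun lam d δ ρ α u < phiFun lam d δ ρ α v :=
  ((phiFun_le_phiLeft hlam hd hα hu).trans_lt (phiLeft_lt_phiFun hlam hd hα h)).trans_le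
    (phiFun_mono hlam hd hα hv)

theorem eventually_abs_le (y : ℝ) : ∀ᶠ z in 𝓝 y, |z| ≤ |y| + 1 :=
  (continuous_abs.tendsto y).eventually_le_const (lt_add_one _)

theorem tendsto_phiFun_nhdsLT (hlam : lam ∈ Ioo (0 : ℝ) 1) (hd : d ∈ Ioo (0 : ℝ) (1 - lam))
    (hα : α ∈ Icc (0 : ℝ) 1) (y : ℝ) :
    Tendsto (phiFun lam d δ ρ α) (𝓝[<] y) (𝓝 (phiLeft lam d δ ρ α y)) := by
  refine Tendsto.const_add _ (Tendsto.const_mul _ (tendsto_tsum_pow_mul hlam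
    (C := |y| + 1 + |ρ| + 3) ?_ fun k => ?_))
  · filter_upwards [nhdsWithin_le_nhds (eventually_abs_le y)] with z hz k
    exact abs_orbit_le le_rfl hz k (abs_psiFun_le hlam hd hα _)
  · exact (tendsto_sub_const_nhdsLT y _).eventually (eventually_psiFun_eq_psiLeft hα _)

theorem tendsto_phiFun_nhdsGE (hlam : lam ∈ Ioo (0 : ℝ) 1) (hd : d ∈ Ioo (0 : ℝ) (1 - lam))
    (hα : α ∈ Icc (0 : ℝ) 1) (y : ℝ) :
    Tendsto (phiFun lam d δ ρ α) (𝓝[≥] y) (𝓝 (phiFun lam d δ ρ α y)) := by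
  refine Tendsto.const_add _ (Tendsto.const_mul _ (tendsto_tsum_pow_mul hlam
    (C := |y| + 1 + |ρ| + 3) ?_ fun k => ?_))
  · filter_upwards [nhdsWithin_le_nhds (eventually_abs_le y)] with z hz k
    exact abs_orbit_le le_rfl hz k (abs_psiFun_le hlam hd hα _)
  · exact (tendsto_sub_const_nhdsGE y _).eventually (eventually_psiFun_eq hα _)

/-! ### The interval ends `deltaFun` and `aFun` -/

theorem tendsto_sub_mul_nhdsGT (y : ℝ) {c : ℝ} (hc : 0 < c) :
    Tendsto (fun r => y - c * r) (𝓝[>] ρ) (𝓝[<] (y - c * ρ)) :=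
  tendsto_nhdsWithin_of_tendsto_nhds_of_eventually_within _
    ((Continuous.tendsto (by fun_prop) ρ).mono_left nhdsWithin_le_nhds)
    (by
      filter_upwards [self_mem_nhdsWithin] with r hr
      exact sub_lt_sub_left (mul_lt_mul_of_pos_left hr hc) y)

theorem tendsto_sub_mul_nhdsLT (y : ℝ) {c : ℝ} (hc : 0 < c) :
    Tendsto (fun r => y - c * r) (𝓝[<] ρ) (𝓝[>] (y - c * ρ)) :=
  tendsto_nhdsWithin_of_tendsto_nhds_of_eventually_within _
    ((Continuous.tendsto (by fun_prop) ρ).mono_left nhdsWithin_le_nhds)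
    (by
      filter_upwards [self_mem_nhdsWithin] with r hr
      exact sub_lt_sub_left (mul_lt_mul_of_pos_left hr hc) y)

/-- As `r` decreases to `ρ`, each α - kr increases to α - kρ, so the limit in `r` is a left limit in
the point. -/
theorem tendsto_aFun (hlam : lam ∈ Ioo (0 : ℝ) 1) (hd : d ∈ Ioo (0 : ℝ) (1 - lam))
    (hα : α ∈ Icc (0 : ℝ) 1) :
    Tendsto (fun r => aFun lam d δ r α) (𝓝[>] ρ) (𝓝 (phiLeft lam d δ ρ α α)) := by
  refine Tendsto.const_add _ (Tendsto.const_mul _ (tendsto_tsum_pow_mul hlam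
    (g := fun r k => psiFun lam d α (α - ((k + 1 : ℕ) : ℝ) * r))
    (C := |α| + (|ρ| + 1) + 3) ?_ fun k => ?_))
  · filter_upwards [nhdsWithin_le_nhds (eventually_abs_le ρ)] with r hr k
    exact abs_orbit_le hr le_rfl k (abs_psiFun_le hlam hd hα _)
  · exact (tendsto_sub_mul_nhdsGT α (by positivity)).eventually
      (eventually_psiFun_eq_psiLeft hα _)

theorem tendsto_phiLeft_zero (hlam : lam ∈ Ioo (0 : ℝ) 1) (hd : d ∈ Ioo (0 : ℝ) (1 - lam))
    (hα : α ∈ Icc (0 : ℝ) 1) :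
    Tendsto (fun r => phiLeft lam d δ r α 0) (𝓝[<] ρ) (𝓝 (phiFun lam d δ ρ α 0)) := by
  refine Tendsto.const_add _ (Tendsto.const_mul _ (tendsto_tsum_pow_mul hlam
    (g := fun r k => psiLeft lam d α (0 - ((k + 1 : ℕ) : ℝ) * r))
    (C := |0| + (|ρ| + 1) + 3) ?_ fun k => ?_))
  · filter_upwards [nhdsWithin_le_nhds (eventually_abs_le ρ)] with r hr k
    exact abs_orbit_le hr le_rfl k (abs_psiLeft_le hlam hd hα _)
  · exact (tendsto_sub_mul_nhdsLT 0 (by positivity)).eventually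
      (eventually_psiLeft_eq_psiFun hα _)

theorem psiFun_one_sub (hα : α ∈ Icc (0 : ℝ) 1) (z : ℝ) :
    psiFun lam d (1 - α) z = -psiLeft lam d α (0 - z) - (1 - lam - d) := by
  have hα' : 1 - α ∈ Icc (0 : ℝ) 1 := ⟨by linarith [hα.2], by linarith [hα.1]⟩
  rw [psiFun_eq hα', psiLeft, zero_sub, Int.ceil_neg, show -z - α = -(z + α) by ring, Int.ceil_neg,
    show z - (1 - α) = z + α - 1 by ring, Int.floor_sub_one]
  push_cast; ring

/-- The reflection z ↦ -z exchanges floors with ceilings, hence ψ_{1-α} with the left limit of ψ_α.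
The right side does not depend on `δ`; taking `δ` to be the parameter itself turns bounds on it into
signs of φ near 0. -/
theorem deltaFun_eq (hlam : lam ∈ Ioo (0 : ℝ) 1) (hd : d ∈ Ioo (0 : ℝ) (1 - lam))
    (hα : α ∈ Icc (0 : ℝ) 1) (r : ℝ) :
    deltaFun lam d r α = δ - (1 - lam) * phiLeft lam d δ r α 0 := by
  have h0 : lam ≠ 0 := hlam.1.ne'
  have h1 : 1 - lam ≠ 0 := by linarith [hlam.2]
  have hs : Summable fun k : ℕ => lam ^ (k + 1) := by
    simp_rw [pow_succ]
    exact (summable_geometric_of_lt_one hlam.1.le hlam.2).mul_right _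
  have : ∀ k : ℕ, lam ^ (k + 1) * psiFun lam d (1 - α) (((k + 1 : ℕ) : ℝ) * r)
      = -(lam ^ (k + 1) * psiLeft lam d α (0 - ((k + 1 : ℕ) : ℝ) * r))
        - lam ^ (k + 1) * (1 - lam - d) := by
    intro k
    rw [psiFun_one_sub hα]; ring
  have h2 : deltaFun lam d r α = 1 - lam - d + (1 - lam) / lam *
    ∑' k : ℕ, lam ^ (k + 1) * psiFun lam d (1 - α) (((k + 1 : ℕ) : ℝ) * r) := rfl
  rw [h2, phiLeft]
  simp_rw [this]
  rw [(summable_psiLeft hlam hd hα r 0).neg.tsum_sub (hs.mul_right _), tsum_mul_right,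
    tsum_pow_succ hlam, tsum_neg]
  generalize (∑' k : ℕ, lam ^ (k + 1) * psiLeft lam d α (0 - ((k + 1 : ℕ) : ℝ) * r)) = S
  field_simp
  ring

theorem tendsto_deltaFun (hlam : lam ∈ Ioo (0 : ℝ) 1) (hd : d ∈ Ioo (0 : ℝ) (1 - lam))
    (hα : α ∈ Icc (0 : ℝ) 1) (δ : ℝ) :
    Tendsto (fun r => deltaFun lam d r α) (𝓝[<] ρ)
      (𝓝 (δ - (1 - lam) * phiFun lam d δ ρ α 0)) := by
  simp_rw [deltaFun_eq (δ := δ) hlam hd hα]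
  exact ((tendsto_phiLeft_zero hlam hd hα).const_mul _).const_sub _

/-! ### Irrational density and rational periodicity -/

/-- Positive multiples of an irrational number are dense modulo `1`. -/
theorem Irrational.exists_nat_mul_mem_Ioo (hρ : Irrational ρ) {u v : ℝ} (h : u < v) :
    ∃ (k : ℕ) (m : ℤ), 0 < k ∧ m + k * ρ ∈ Ioo u v := by
  have hd : DenseRange fun n : ℕ => n • (ρ : AddCircle (1 : ℝ)) := by
    rw [← denseRange_zsmul_iff_nsmul, AddCircle.denseRange_zsmul_coe_iff]
    simpa using hρ
  obtain ⟨n, x, hx, hn⟩ := hd.exists_mem_open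
    (QuotientAddGroup.isOpenMap_coe (N := AddSubgroup.zmultiples (1 : ℝ)) _
      (isOpen_Ioo (a := u - ρ) (b := v - ρ))) ((nonempty_Ioo.2 (by linarith)).image _)
  have hn' : ((x - n * ρ : ℝ) : AddCircle (1 : ℝ)) = 0 := by
    rw [AddCircle.coe_sub, sub_eq_zero, ← nsmul_eq_mul, AddCircle.coe_nsmul]
    exact hn
  obtain ⟨m, hm⟩ := (AddCircle.coe_eq_zero_iff (1 : ℝ)).1 hn'
  refine ⟨n + 1, m, n.succ_pos, ?_⟩
  have : (m : ℝ) + ((n + 1 : ℕ) : ℝ) * ρ = x + ρ := by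
    rw [zsmul_eq_mul, mul_one] at hm
    rw [hm]; push_cast; ring
  rw [this]
  exact ⟨by linarith [hx.1], by linarith [hx.2]⟩

/-- Between any two points lies some m + kρ with k ≥ 1, where φ jumps. -/
theorem phiFun_strictMono (hlam : lam ∈ Ioo (0 : ℝ) 1) (hd : d ∈ Ioo (0 : ℝ) (1 - lam))
    (hα : α ∈ Icc (0 : ℝ) 1) (hρ : Irrational ρ) : StrictMono (phiFun lam d δ ρ α) := by
  intro u v h
  obtain ⟨k, m, hk, hm⟩ := hρ.exists_nat_mul_mem_Ioo h
  exact phiFun_lt_phiFun hlam hd hα hm.1 hm.2.le ⟨k, m, hk, Or.inl (by ring)⟩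

theorem exists_mul_eq_of_not_irrational (hρ : ¬ Irrational ρ) :
    ∃ (p : ℤ) (q : ℕ), 0 < q ∧ q * ρ = p := by
  obtain ⟨r, rfl⟩ := not_not.1 hρ
  refine ⟨r.num, r.den, r.den_pos, ?_⟩
  exact_mod_cast Rat.den_mul_eq_num r

/-- For rational `ρ`, the whole backward orbits of `y` and of the points close to it on the left
see the same floors. -/
theorem eventually_forall_floor_left {p : ℤ} {q : ℕ} (hq : 0 < q) (hρ : q * ρ = p) (α y : ℝ) :
    ∀ᶠ z in 𝓝[<] y, ∀ k : ℕ, ⌊z - k * ρ⌋ = ⌈y - k * ρ⌉ - 1 ∧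
      ⌊z - k * ρ - α⌋ = ⌈y - k * ρ - α⌉ - 1 := by
  have h : ∀ᶠ z in 𝓝[<] y, ∀ s ∈ Finset.range q, ⌊z - s * ρ⌋ = ⌈y - s * ρ⌉ - 1 ∧
      ⌊z - s * ρ - α⌋ = ⌈y - s * ρ - α⌉ - 1 := by
    rw [Finset.eventually_all]
    intro s _
    exact (tendsto_sub_const_nhdsLT y (s * ρ)).eventually (eventually_floor_left α _)
  filter_upwards [h] with z hz k
  obtain ⟨h1, h2⟩ := hz (k % q) (Finset.mem_range.2 (Nat.mod_lt k hq))
  -- Modulo an integer kρ depends only on k mod q, so finitely many conditions suffice.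
  have hk : (k : ℝ) * ρ = (k % q : ℕ) * ρ + (((k / q : ℕ) : ℤ) * p : ℤ) := by
    conv_lhs => rw [← Nat.mod_add_div k q]
    rw [Nat.cast_add, Nat.cast_mul, Int.cast_mul, Int.cast_natCast, ← hρ]; ring
  rw [hk, ← sub_sub, ← sub_sub, sub_right_comm (z - _) _ α, sub_right_comm (y - _) _ α, Int.floor_sub_intCast,
    Int.floor_sub_intCast, Int.ceil_sub_intCast, Int.ceil_sub_intCast, h1, h2]
  constructor <;> ring

theorem phiFun_eq_phiLeft_of_floor (hα : α ∈ Icc (0 : ℝ) 1) {y z : ℝ}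
    (h : ∀ k : ℕ, ⌊z - k * ρ⌋ = ⌈y - k * ρ⌉ - 1 ∧ ⌊z - k * ρ - α⌋ = ⌈y - k * ρ - α⌉ - 1) :
    phiFun lam d δ ρ α z = phiLeft lam d δ ρ α y := by
  rw [phiFun, phiLeft]
  congr 3 with k
  rw [psiFun_eq hα, psiLeft, (h (k + 1)).1, (h (k + 1)).2]

/-- Source of the rational exception: for irrational `ρ` strict monotonicity keeps φ below its left
limit, while for rational `ρ` the left limit is a value of φ and must differ from `c`. -/
theorem forall_phiFun_lt_iff (hlam : lam ∈ Ioo (0 : ℝ) 1) (hd : d ∈ Ioo (0 : ℝ) (1 - lam))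
    (hα : α ∈ Icc (0 : ℝ) 1) (w c : ℝ) :
    (∀ y < w, phiFun lam d δ ρ α y < c) ↔
      phiLeft lam d δ ρ α w ≤ c ∧ (¬ Irrational ρ → phiLeft lam d δ ρ α w ≠ c) := by
  constructor
  · intro h
    refine ⟨le_of_tendsto (tendsto_phiFun_nhdsLT hlam hd hα w) ?_, fun hρ => ?_⟩
    · filter_upwards [self_mem_nhdsWithin] with y hy using (h y hy).le
    · obtain ⟨p, q, hq, hpq⟩ := exists_mul_eq_of_not_irrational hρ
      obtain ⟨z, hz, hzw⟩ := ((eventually_forall_floor_left hq hpq α w).and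
        self_mem_nhdsWithin).exists
      rw [← phiFun_eq_phiLeft_of_floor hα hz]
      exact (h z hzw).ne
  · rintro ⟨h1, h2⟩ y hy
    by_cases hρ : Irrational ρ
    · have h3 : y < (y + w) / 2 := by linarith
      exact (phiFun_strictMono hlam hd hα hρ h3).trans_le
        ((phiFun_le_phiLeft hlam hd hα (by linarith)).trans h1)
    · exact (phiFun_le_phiLeft hlam hd hα hy).trans_lt (h1.lt_of_ne (h2 hρ))

/-! ### Compatibility and the interval conditions -/

/-- The lift `phiFun` respects the partitions of the line by the integers and by the translates of
`α` on the one side, of `a` on the other. -/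
def IsCompatible (lam d δ a ρ α : ℝ) : Prop :=
  ∀ y, (0 ≤ phiFun lam d δ ρ α y ↔ 0 ≤ y) ∧ (a ≤ phiFun lam d δ ρ α y ↔ α ≤ y)

/-- By monotonicity compatibility only concerns 0 and `α`. The bounds on `δ` encode φ(0) ≥ 0 and φ <
0 before 0; those on `a` encode φ(α) ≥ a and φ < a before `α`. -/
theorem intervalConditions_iff (hlam : lam ∈ Ioo (0 : ℝ) 1) (hd : d ∈ Ioo (0 : ℝ) (1 - lam))
    (hα : α ∈ Icc (0 : ℝ) 1) :
    IntervalConditions lam d δ a ρ α ↔ IsCompatible lam d δ a ρ α := by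
  have hl : 0 < 1 - lam := by linarith [hlam.2]
  have hmono := phiFun_mono (δ := δ) (ρ := ρ) hlam hd hα
  have key : IsCompatible lam d δ a ρ α ↔
      (0 ≤ phiFun lam d δ ρ α 0 ∧ ∀ y < 0, phiFun lam d δ ρ α y < 0) ∧
      (a ≤ phiFun lam d δ ρ α α ∧ ∀ y < α, phiFun lam d δ ρ α y < a) := by
    constructor
    · intro h
      refine ⟨⟨(h 0).1.2 le_rfl, fun y hy => ?_⟩, (h α).2.2 le_rfl, fun y hy => ?_⟩
      · exact not_le.1 fun h' => hy.not_ge ((h y).1.1 h')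
      · exact not_le.1 fun h' => hy.not_ge ((h y).2.1 h')
    · rintro ⟨⟨h1, h2⟩, h3, h4⟩ y
      exact ⟨⟨fun h => not_lt.1 fun hy => (h2 y hy).not_ge h, fun h => h1.trans (hmono h)⟩,
        fun h => not_lt.1 fun hy => (h4 y hy).not_ge h, fun h => h3.trans (hmono h)⟩
  rw [key, forall_phiFun_lt_iff hlam hd hα, forall_phiFun_lt_iff hlam hd hα]
  have e1 : ∀ x : ℝ, δ - (1 - lam) * x ≤ δ ↔ 0 ≤ x := fun x => by
    rw [sub_le_self_iff, mul_nonneg_iff_of_pos_left hl]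
  have e2 : ∀ x : ℝ, δ ≤ δ - (1 - lam) * x ↔ x ≤ 0 := fun x => by
    rw [le_sub_self_iff]
    exact ⟨fun h => by nlinarith, fun h => by nlinarith⟩
  have e3 : ∀ x : ℝ, δ ≠ δ - (1 - lam) * x ↔ x ≠ 0 := fun x => by
    rw [Ne, eq_comm, sub_eq_self, mul_eq_zero, or_iff_right hl.ne']
  constructor
  · rintro ⟨dl, ar, hdl, har, hδ, ha, hne⟩
    obtain rfl := tendsto_nhds_unique hdl (tendsto_deltaFun hlam hd hα δ)
    obtain rfl := tendsto_nhds_unique har (tendsto_aFun hlam hd hα)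
    rw [deltaFun_eq (δ := δ) hlam hd hα] at hδ hne
    exact ⟨⟨(e1 _).1 hδ.1, (e2 _).1 hδ.2, fun h => (e3 _).1 (hne h).1⟩, ha.2, ha.1,
      fun h => (hne h).2.symm⟩
  · rintro ⟨⟨h1, h2, h3⟩, h4, h5, h6⟩
    refine ⟨_, _, tendsto_deltaFun hlam hd hα δ, tendsto_aFun hlam hd hα, ?_, ⟨h5, h4⟩, ?_⟩
    · rw [deltaFun_eq (δ := δ) hlam hd hα]
      exact ⟨(e1 _).2 h1, (e2 _).2 h2⟩
    · rw [deltaFun_eq (δ := δ) hlam hd hα]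
      exact fun h => ⟨(e3 _).2 (h3 h), (h6 h).symm⟩

/-- Compatibility can be checked on `[0, 1)`. -/
theorem isCompatible_of_forall_Ico (hlam : lam ∈ Ioo (0 : ℝ) 1) (hd : d ∈ Ioo (0 : ℝ) (1 - lam))
    (ha : a ∈ Icc (0 : ℝ) 1) (hα : α ∈ Icc (0 : ℝ) 1)
    (h : ∀ y ∈ Ico (0 : ℝ) 1, phiFun lam d δ ρ α y ∈ Ico (0 : ℝ) 1 ∧
      (a ≤ phiFun lam d δ ρ α y ↔ α ≤ y)) : IsCompatible lam d δ a ρ α := by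
  intro y
  obtain ⟨h1, h2⟩ := h (Int.fract y) ⟨Int.fract_nonneg y, Int.fract_lt_one y⟩
  have hy : phiFun lam d δ ρ α y = phiFun lam d δ ρ α (Int.fract y) + ⌊y⌋ := by
    rw [← phiFun_add_int hlam hd hα, Int.fract_add_floor]
  rcases lt_trichotomy ⌊y⌋ 0 with hm | hm | hm
  · have hm' : (⌊y⌋ : ℝ) ≤ -1 := by exact_mod_cast Int.le_sub_one_of_lt hm
    have h0 : y < 0 := by
      have := Int.lt_floor_add_one y
      linarith
    have h3 : phiFun lam d δ ρ α y < 0 := by linarith [h1.2]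
    exact ⟨⟨fun h' => by linarith, fun h' => by linarith⟩, ⟨fun h' => by linarith [ha.1], fun h' => by linarith [hα.1]⟩⟩
  · have e : Int.fract y = y := by rw [← Int.self_sub_floor, hm]; simp
    rw [e] at h1 h2
    have : 0 ≤ y := e ▸ Int.fract_nonneg y
    exact ⟨⟨fun _ => this, fun _ => h1.1⟩, h2⟩
  · have hm' : (1 : ℝ) ≤ ⌊y⌋ := by exact_mod_cast hm
    have h0 : 1 ≤ y := hm'.trans (Int.floor_le y)
    have h3 : 1 ≤ phiFun lam d δ ρ α y := by linarith [h1.1]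
    exact ⟨⟨fun _ => by linarith, fun _ => by linarith⟩, ⟨fun _ => by linarith [hα.2],
      fun _ => by linarith [ha.2]⟩⟩

/-! ### The lift of f and the semiconjugacy -/

theorem liftMap_eq (x : ℝ) : liftMap lam d δ a x = lam * x + δ + psiFun lam d a x := by
  rw [liftMap, psiFun]; ring

theorem liftMap_strictMono (hlam : lam ∈ Ioo (0 : ℝ) 1) (hd : d ∈ Ioo (0 : ℝ) (1 - lam))
    (ha : a ∈ Icc (0 : ℝ) 1) : StrictMono (liftMap lam d δ a) := by
  intro x y h
  rw [liftMap_eq, liftMap_eq]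
  have := psiFun_mono hd ha h.le
  have := mul_lt_mul_of_pos_left h hlam.1
  linarith

theorem liftMap_add_int (x : ℝ) (m : ℤ) :
    liftMap lam d δ a (x + m) = liftMap lam d δ a x + m := by
  rw [liftMap_eq, liftMap_eq, psiFun_add_int]; ring

theorem pcMap_add_int (x : ℝ) (m : ℤ) : pcMap lam d δ a (x + m) = pcMap lam d δ a x := by
  rw [pcMap, pcMap, liftMap_add_int, Int.fract_add_intCast]

theorem pcMap_mem (x : ℝ) : pcMap lam d δ a x ∈ Ico (0 : ℝ) 1 :=
  ⟨Int.fract_nonneg _, Int.fract_lt_one _⟩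

theorem rotMap_mem (y : ℝ) : rotMap ρ y ∈ Ico (0 : ℝ) 1 :=
  ⟨Int.fract_nonneg _, Int.fract_lt_one _⟩

theorem iterate_rotMap {y : ℝ} (hy : y ∈ Ico (0 : ℝ) 1) (n : ℕ) :
    (rotMap ρ)^[n] y = Int.fract (y + n * ρ) := by
  induction n with
  | zero => simpa using (Int.fract_eq_self.2 hy).symm
  | succ n ih =>
    rw [Function.iterate_succ_apply', ih, rotMap, Int.fract_eq_fract]
    refine ⟨-⌊y + n * ρ⌋, ?_⟩
    rw [← Int.self_sub_floor]; push_cast; ring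

namespace IsCompatible

theorem le_add_int_iff (hlam : lam ∈ Ioo (0 : ℝ) 1) (hd : d ∈ Ioo (0 : ℝ) (1 - lam))
    (hα : α ∈ Icc (0 : ℝ) 1) (h : IsCompatible lam d δ a ρ α) (y : ℝ) (m : ℤ) :
    ((m : ℝ) ≤ phiFun lam d δ ρ α y ↔ (m : ℝ) ≤ y) ∧
      (m + a ≤ phiFun lam d δ ρ α y ↔ m + α ≤ y) := by
  have e : phiFun lam d δ ρ α (y - m) = phiFun lam d δ ρ α y - m := by
    have := phiFun_add_int (δ := δ) (ρ := ρ) hlam hd hα (y - m) m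
    rw [sub_add_cancel] at this
    linarith
  obtain ⟨h1, h2⟩ := h (y - m)
  rw [e, sub_nonneg, sub_nonneg] at h1
  rw [e, le_sub_iff_add_le', le_sub_iff_add_le'] at h2
  exact ⟨h1, h2⟩

theorem floor_phiFun (hlam : lam ∈ Ioo (0 : ℝ) 1) (hd : d ∈ Ioo (0 : ℝ) (1 - lam))
    (hα : α ∈ Icc (0 : ℝ) 1) (h : IsCompatible lam d δ a ρ α) (y : ℝ) :
    ⌊phiFun lam d δ ρ α y⌋ = ⌊y⌋ :=
  eq_of_forall_le_iff fun m => by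
    rw [Int.le_floor, Int.le_floor, (h.le_add_int_iff hlam hd hα y m).1]

theorem floor_phiFun_sub (hlam : lam ∈ Ioo (0 : ℝ) 1) (hd : d ∈ Ioo (0 : ℝ) (1 - lam))
    (hα : α ∈ Icc (0 : ℝ) 1) (h : IsCompatible lam d δ a ρ α) (y : ℝ) :
    ⌊phiFun lam d δ ρ α y - a⌋ = ⌊y - α⌋ :=
  eq_of_forall_le_iff fun m => by
    rw [Int.le_floor, Int.le_floor, le_sub_iff_add_le, le_sub_iff_add_le,
      (h.le_add_int_iff hlam hd hα y m).2]

theorem phiFun_mem_iff (hlam : lam ∈ Ioo (0 : ℝ) 1) (hd : d ∈ Ioo (0 : ℝ) (1 - lam))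
    (hα : α ∈ Icc (0 : ℝ) 1) (h : IsCompatible lam d δ a ρ α) {y : ℝ} :
    phiFun lam d δ ρ α y ∈ Ico (0 : ℝ) 1 ↔ y ∈ Ico (0 : ℝ) 1 := by
  have := h.floor_phiFun hlam hd hα y
  rw [← Int.floor_eq_zero_iff, ← Int.floor_eq_zero_iff, this]

theorem phiFun_fract (hlam : lam ∈ Ioo (0 : ℝ) 1) (hd : d ∈ Ioo (0 : ℝ) (1 - lam))
    (hα : α ∈ Icc (0 : ℝ) 1) (h : IsCompatible lam d δ a ρ α) (y : ℝ) :
    phiFun lam d δ ρ α (Int.fract y) = Int.fract (phiFun lam d δ ρ α y) := by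
  have := phiFun_add_int (δ := δ) (ρ := ρ) hlam hd hα (Int.fract y) ⌊y⌋
  rw [Int.fract_add_floor] at this
  rw [← Int.self_sub_floor (phiFun _ _ _ _ _ _), h.floor_phiFun hlam hd hα]
  linarith

/-- F and the functional equation of φ differ only in their floors, which compatibility makes equal.
-/
theorem liftMap_phiFun (hlam : lam ∈ Ioo (0 : ℝ) 1) (hd : d ∈ Ioo (0 : ℝ) (1 - lam))
    (ha : a ∈ Icc (0 : ℝ) 1)
    (hα : α ∈ Icc (0 : ℝ) 1) (h : IsCompatible lam d δ a ρ α) (y : ℝ) :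
    liftMap lam d δ a (phiFun lam d δ ρ α y) = phiFun lam d δ ρ α (y + ρ) := by
  rw [liftMap_eq, phiFun_add hlam hd hα, psiFun_eq ha, psiFun_eq hα, h.floor_phiFun hlam hd hα,
    h.floor_phiFun_sub hlam hd hα]

theorem pcMap_phiFun (hlam : lam ∈ Ioo (0 : ℝ) 1) (hd : d ∈ Ioo (0 : ℝ) (1 - lam))
    (ha : a ∈ Icc (0 : ℝ) 1)
    (hα : α ∈ Icc (0 : ℝ) 1) (h : IsCompatible lam d δ a ρ α) (y : ℝ) :
    pcMap lam d δ a (phiFun lam d δ ρ α y) = phiFun lam d δ ρ α (rotMap ρ y) := by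
  rw [pcMap, h.liftMap_phiFun hlam hd ha hα, rotMap, h.phiFun_fract hlam hd hα]

theorem iterate_pcMap_phiFun (hlam : lam ∈ Ioo (0 : ℝ) 1) (hd : d ∈ Ioo (0 : ℝ) (1 - lam))
    (ha : a ∈ Icc (0 : ℝ) 1)
    (hα : α ∈ Icc (0 : ℝ) 1) (h : IsCompatible lam d δ a ρ α) (n : ℕ) (y : ℝ) :
    (pcMap lam d δ a)^[n] (phiFun lam d δ ρ α y) = phiFun lam d δ ρ α ((rotMap ρ)^[n] y) :=
  ((Function.Semiconj.iterate_right
    (fun y => (h.pcMap_phiFun hlam hd ha hα y).symm) n) y).symm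

end IsCompatible

theorem conjugacyCondition_iff (hlam : lam ∈ Ioo (0 : ℝ) 1) (hd : d ∈ Ioo (0 : ℝ) (1 - lam))
    (ha : a ∈ Icc (0 : ℝ) 1) (hα : α ∈ Icc (0 : ℝ) 1) :
    ConjugacyCondition lam d δ a ρ α ↔ IsCompatible lam d δ a ρ α := by
  constructor
  · rintro ⟨h1, h2⟩
    have hmem : ∀ y ∈ Ico (0 : ℝ) 1, phiFun lam d δ ρ α y ∈ Ico (0 : ℝ) 1 :=
      fun y hy => h1 (mem_image_of_mem _ hy)
    refine isCompatible_of_forall_Ico hlam hd ha hα fun y hy => ⟨hmem y hy, ?_⟩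
    have h3 := h2 y hy
    have h4 : phiFun lam d δ ρ α (rotMap ρ y) = Int.fract (phiFun lam d δ ρ α (y + ρ)) := by
      have h5 := phiFun_add_int (δ := δ) (ρ := ρ) hlam hd hα (Int.fract (y + ρ)) ⌊y + ρ⌋
      rw [Int.fract_add_floor] at h5
      rw [h5, Int.fract_add_intCast]
      exact (Int.fract_eq_self.2 (hmem _ (rotMap_mem y))).symm
    rw [h4, pcMap, Int.fract_eq_fract, liftMap_eq, phiFun_add hlam hd hα] at h3
    obtain ⟨m, hm⟩ := h3
    rw [← stepTheta_eq_stepTheta_iff]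
    rw [psiFun, psiFun, Int.floor_eq_zero_iff.2 hy, Int.floor_eq_zero_iff.2 (hmem y hy),
      Int.fract_eq_self.2 hy, Int.fract_eq_self.2 (hmem y hy)] at hm
    have hm' : d * (stepTheta a (phiFun lam d δ ρ α y) - stepTheta α y) = m := by
      rw [← hm]; ring
    have hd1 : d < 1 := by linarith [hd.2, hlam.1]
    -- Conjugacy modulo 1 makes d times the difference of the symbols an integer; since 0 < d < 1
    -- the difference cannot be ±1.
    have h6 : ∀ {e : ℝ}, d * e = m → e = 1 ∨ e = -1 → False := by
      rintro e he (rfl | rfl)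
      · have h7 : (0 : ℝ) < m := by rw [← he]; linarith [hd.1]
        have h8 : (m : ℝ) < 1 := by rw [← he]; linarith
        norm_cast at h7 h8; omega
      · have h7 : (m : ℝ) < 0 := by rw [← he]; linarith [hd.1]
        have h8 : (-1 : ℝ) < m := by rw [← he]; linarith
        have h9 : (-1 : ℤ) < m := by exact_mod_cast h8
        norm_cast at h7; omega
    rcases lt_or_ge (phiFun lam d δ ρ α y) a with h | h <;> rcases lt_or_ge y α with h' | h'
    · rw [stepTheta_of_lt h, stepTheta_of_lt h']
    · rw [stepTheta_of_lt h, stepTheta_of_le h'] at hm'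
      exact (h6 hm' (Or.inr (by norm_num))).elim
    · rw [stepTheta_of_le h, stepTheta_of_lt h'] at hm'
      exact (h6 hm' (Or.inl (by norm_num))).elim
    · rw [stepTheta_of_le h, stepTheta_of_le h']
  · intro h
    refine ⟨?_, fun y _ => h.pcMap_phiFun hlam hd ha hα y⟩
    rintro _ ⟨y, hy, rfl⟩
    exact (h.phiFun_mem_iff hlam hd hα).2 hy

/-! ### Coding -/

theorem iterate_rotMap_fract (y : ℝ) (n : ℕ) :
    (rotMap ρ)^[n] (Int.fract y) = Int.fract (y + n * ρ) := by
  rw [iterate_rotMap ⟨Int.fract_nonneg _, Int.fract_lt_one _⟩, Int.fract_eq_fract]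
  refine ⟨-⌊y⌋, ?_⟩
  rw [← Int.self_sub_floor]; push_cast; ring

theorem liftMap_of_mem {x : ℝ} (hx : x ∈ Ico (0 : ℝ) 1) :
    liftMap lam d δ a x = lam * x + δ + d * stepTheta a x := by
  rw [liftMap, Int.floor_eq_zero_iff.2 hx, Int.fract_eq_self.2 hx]; simp

/-- The point η is where F crosses 1: on the branch to the right of `a` here, at the jump `a` itself
in the second region, on the branch to the left of `a` in the third. -/
theorem one_le_liftMap_iff_etaOne (hlam : 0 < lam) (h : a ≤ etaOne lam d δ) {x : ℝ}
    (hd : 0 < d) (hx : x ∈ Ico (0 : ℝ) 1) :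
    1 ≤ liftMap lam d δ a x ↔ etaOne lam d δ ≤ x := by
  rw [liftMap_of_mem hx, etaOne, div_le_iff₀ hlam]
  rw [etaOne, le_div_iff₀ hlam] at h
  rcases lt_or_ge x a with h' | h'
  · have := mul_lt_mul_of_pos_left h' hlam
    rw [stepTheta_of_lt h']
    constructor <;> intro <;> linarith
  · rw [stepTheta_of_le h']
    constructor <;> intro <;> linarith

theorem one_le_liftMap_iff_self (hlam : 0 < lam) (h : a ∈ Icc (etaOne lam d δ) (etaTwo lam δ))
    {x : ℝ} (hx : x ∈ Ico (0 : ℝ) 1) : 1 ≤ liftMap lam d δ a x ↔ a ≤ x := by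
  obtain ⟨h1, h2⟩ := h
  rw [liftMap_of_mem hx]
  rw [etaOne, div_le_iff₀ hlam] at h1
  rw [etaTwo, le_div_iff₀ hlam] at h2
  rcases lt_or_ge x a with h' | h'
  · have := mul_lt_mul_of_pos_left h' hlam
    rw [stepTheta_of_lt h']
    constructor <;> intro <;> linarith
  · have := mul_le_mul_of_nonneg_left h' hlam.le
    rw [stepTheta_of_le h']
    constructor <;> intro <;> linarith

theorem one_le_liftMap_iff_etaTwo (hlam : 0 < lam) (hd : 0 < d) (h : etaTwo lam δ < a) {x : ℝ}
    (hx : x ∈ Ico (0 : ℝ) 1) : 1 ≤ liftMap lam d δ a x ↔ etaTwo lam δ ≤ x := by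
  rw [liftMap_of_mem hx, etaTwo, div_le_iff₀ hlam]
  rw [etaTwo, div_lt_iff₀ hlam] at h
  rcases lt_or_ge x a with h' | h'
  · rw [stepTheta_of_lt h']
    constructor <;> intro <;> linarith
  · have := mul_le_mul_of_nonneg_left h' hlam.le
    rw [stepTheta_of_le h']
    constructor <;> intro <;> linarith

/-- F(φ(y)) = φ(y + ρ) reaches 1 exactly when y + ρ does. -/
theorem IsCompatible.le_iff_le {η : ℝ} (hlam : lam ∈ Ioo (0 : ℝ) 1)
    (hd : d ∈ Ioo (0 : ℝ) (1 - lam)) (ha : a ∈ Icc (0 : ℝ) 1) (hα : α ∈ Icc (0 : ℝ) 1)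
    (hη : ∀ x ∈ Ico (0 : ℝ) 1, 1 ≤ liftMap lam d δ a x ↔ η ≤ x)
    (h : IsCompatible lam d δ a ρ α) {y : ℝ} (hy : y ∈ Ico (0 : ℝ) 1) :
    η ≤ phiFun lam d δ ρ α y ↔ 1 - ρ ≤ y := by
  rw [← hη _ ((h.phiFun_mem_iff hlam hd hα).2 hy), h.liftMap_phiFun hlam hd ha hα,
    sub_le_iff_le_add]
  simpa using (h.le_add_int_iff hlam hd hα (y + ρ) 1).1

theorem IsCompatible.sameCodes {η : ℝ} (hlam : lam ∈ Ioo (0 : ℝ) 1)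
    (hd : d ∈ Ioo (0 : ℝ) (1 - lam)) (ha : a ∈ Icc (0 : ℝ) 1) (hα : α ∈ Icc (0 : ℝ) 1)
    (hη : ∀ x ∈ Ico (0 : ℝ) 1, 1 ≤ liftMap lam d δ a x ↔ η ≤ x)
    (h : IsCompatible lam d δ a ρ α) : SameCodes lam d δ a ρ α η := by
  intro y hy n
  rw [h.iterate_pcMap_phiFun hlam hd ha hα, stepTheta_eq_stepTheta_iff, stepTheta_eq_stepTheta_iff]
  refine ⟨(h _).2, h.le_iff_le hlam hd ha hα hη ?_⟩
  rw [iterate_rotMap hy]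
  exact ⟨Int.fract_nonneg _, Int.fract_lt_one _⟩

/-- The order of `α` and 1 - ρ is that of `a` and η, read off by evaluating the two symbol
equivalences at y = 1 - ρ and y = α. -/
theorem IsCompatible.codingCondition (hlam : lam ∈ Ioo (0 : ℝ) 1)
    (hd : d ∈ Ioo (0 : ℝ) (1 - lam)) (hδ : δ ∈ Ioo (1 - lam - d) 1) (ha : a ∈ Icc (0 : ℝ) 1)
    (hρ : ρ ∈ Ioo (0 : ℝ) 1) (hα : α ∈ Icc (0 : ℝ) 1) (h : IsCompatible lam d δ a ρ α) :
    CodingCondition lam d δ a ρ α := by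
  have hρ' : 1 - ρ ∈ Ico (0 : ℝ) 1 := ⟨by linarith [hρ.2], by linarith [hρ.1]⟩
  rcases lt_or_ge a (etaOne lam d δ) with h1 | h1
  · have hη : ∀ x ∈ Ico (0 : ℝ) 1, 1 ≤ liftMap lam d δ a x ↔ etaOne lam d δ ≤ x :=
      fun x hx => one_le_liftMap_iff_etaOne hlam.1 h1.le hd.1 hx
    refine Or.inl ⟨⟨⟨hδ.1, ?_⟩, ha.1, h1⟩, ⟨hα.1, ?_⟩, h.sameCodes hlam hd ha hα hη⟩
    · have := ha.1.trans_lt h1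
      rw [etaOne, div_pos_iff_of_pos_right hlam.1] at this
      show δ < 1 - d
      linarith
    · exact (h _).2.1 (h1.le.trans ((h.le_iff_le hlam hd ha hα hη hρ').2 le_rfl))
  rcases le_or_gt a (etaTwo lam δ) with h2 | h2
  · have hη : ∀ x ∈ Ico (0 : ℝ) 1, 1 ≤ liftMap lam d δ a x ↔ a ≤ x :=
      fun x hx => one_le_liftMap_iff_self hlam.1 ⟨h1, h2⟩ hx
    refine Or.inr (Or.inl ⟨⟨hδ, ha, h1, h2⟩, le_antisymm ?_ ?_, h.sameCodes hlam hd ha hα hη⟩)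
    · exact (h _).2.1 ((h.le_iff_le hlam hd ha hα hη hρ').2 le_rfl)
    · by_contra! h3
      exact h3.not_ge ((h.le_iff_le hlam hd ha hα hη ⟨hα.1, h3.trans hρ'.2⟩).1 ((h α).2.2 le_rfl))
  · have hη : ∀ x ∈ Ico (0 : ℝ) 1, 1 ≤ liftMap lam d δ a x ↔ etaTwo lam δ ≤ x :=
      fun x hx => one_le_liftMap_iff_etaTwo hlam.1 hd.1 h2 hx
    refine Or.inr (Or.inr ⟨⟨⟨?_, hδ.2⟩, h2, ha.2⟩, ⟨?_, hα.2⟩, h.sameCodes hlam hd ha hα hη⟩)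
    · have := h2.trans_le ha.2
      rw [etaTwo, div_lt_one hlam.1] at this
      show 1 - lam < δ
      linarith
    · by_contra! h3
      exact h3.not_ge ((h.le_iff_le hlam hd ha hα hη ⟨hα.1, h3.trans hρ'.2⟩).1
        (h2.le.trans ((h α).2.2 le_rfl)))

theorem fract_of_mem_Ico_two {x : ℝ} (hx : x ∈ Ico (0 : ℝ) 2) :
    Int.fract x = x - stepTheta 1 x := by
  rcases lt_or_ge x 1 with h | h
  · rw [stepTheta_of_lt h, Int.fract_eq_self.2 ⟨hx.1, h⟩, sub_zero]
  · rw [stepTheta_of_le h, ← Int.fract_sub_one, Int.fract_eq_self.2]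
    exact ⟨by linarith, by linarith [hx.2]⟩

/-- If `x` and `y` have the same symbols, then `pcMap` contracts the error of `phiFun`. -/
theorem pcMap_sub_phiFun_rotMap {η : ℝ} (hlam : lam ∈ Ioo (0 : ℝ) 1)
    (hd : d ∈ Ioo (0 : ℝ) (1 - lam)) (hδ : δ ∈ Ioo (1 - lam - d) 1)
    (hρ : ρ ∈ Ioo (0 : ℝ) 1) (hα : α ∈ Icc (0 : ℝ) 1)
    (hη : ∀ x ∈ Ico (0 : ℝ) 1, 1 ≤ liftMap lam d δ a x ↔ η ≤ x) {x y : ℝ}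
    (hx : x ∈ Ico (0 : ℝ) 1) (hy : y ∈ Ico (0 : ℝ) 1) (h1 : stepTheta a x = stepTheta α y)
    (h2 : stepTheta η x = stepTheta (1 - ρ) y) :
    pcMap lam d δ a x - phiFun lam d δ ρ α (rotMap ρ y) = lam * (x - phiFun lam d δ ρ α y) := by
  have hF : liftMap lam d δ a x ∈ Ico (0 : ℝ) 2 := by
    rw [liftMap_of_mem hx]
    have e : stepTheta a x = 0 ∨ stepTheta a x = 1 := by
      unfold stepTheta; split_ifs <;> simp
    have h3 := mul_nonneg hlam.1.le hx.1
    have h4 := mul_lt_mul_of_pos_left hx.2 hlam.1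
    have h5 := hd.1
    have h6 := hd.2
    have h7 := hδ.1
    have h8 := hδ.2
    rcases e with e | e <;> rw [e] <;> constructor <;> linarith
  have e1 : stepTheta 1 (liftMap lam d δ a x) = stepTheta η x :=
    stepTheta_eq_stepTheta_iff.2 (hη x hx)
  have e2 : stepTheta 1 (y + ρ) = stepTheta (1 - ρ) y :=
    stepTheta_eq_stepTheta_iff.2 sub_le_iff_le_add.symm
  rw [pcMap, rotMap, fract_of_mem_Ico_two hF,
    fract_of_mem_Ico_two ⟨by linarith [hy.1, hρ.1], by linarith [hy.2, hρ.2]⟩, e1, e2, h2,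
    liftMap_of_mem hx, h1]
  have e3 : ∃ m : ℤ, stepTheta (1 - ρ) y = m := by
    unfold stepTheta; split_ifs
    · exact ⟨0, by simp⟩
    · exact ⟨1, by simp⟩
  obtain ⟨m, hm⟩ := e3
  have h3 := phiFun_add_int (δ := δ) (ρ := ρ) hlam hd hα (y + ρ - m) m
  rw [sub_add_cancel, phiFun_add hlam hd hα, psiFun, Int.floor_eq_zero_iff.2 hy,
    Int.fract_eq_self.2 hy] at h3
  rw [hm]
  push_cast at h3
  linarith

/-- Contraction of the error along rotation orbits puts φ in [0,1]. The hypothesis `h0` is needed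
only to exclude the value 1, when δ + d overflows 1 at a = 0. -/
theorem isCompatible_of_sameCodes {η : ℝ} (hlam : lam ∈ Ioo (0 : ℝ) 1)
    (hd : d ∈ Ioo (0 : ℝ) (1 - lam)) (hδ : δ ∈ Ioo (1 - lam - d) 1) (ha : a ∈ Icc (0 : ℝ) 1)
    (hρ : ρ ∈ Ioo (0 : ℝ) 1) (hα : α ∈ Icc (0 : ℝ) 1)
    (hη : ∀ x ∈ Ico (0 : ℝ) 1, 1 ≤ liftMap lam d δ a x ↔ η ≤ x) (hη1 : η ≤ 1)
    (h0 : a = 0 → 1 ≤ δ + d → 0 < α) (h : SameCodes lam d δ a ρ α η) :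
    IsCompatible lam d δ a ρ α := by
  set φ := phiFun lam d δ ρ α with hφ
  set f := pcMap lam d δ a with hf
  have hmono : Monotone φ := phiFun_mono hlam hd hα
  have hone : φ 1 = φ 0 + 1 := by
    have := phiFun_add_int (δ := δ) (ρ := ρ) hlam hd hα 0 1
    simpa using this
  have hrot : ∀ y ∈ Ico (0 : ℝ) 1, ∀ n, (rotMap ρ)^[n] y ∈ Ico (0 : ℝ) 1 := fun y hy n => by
    rw [iterate_rotMap hy]
    exact ⟨Int.fract_nonneg _, Int.fract_lt_one _⟩
  -- The count starts after one step because φ(y) is not yet known to lie in [0,1), whereas f(φ(y))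
  -- does.
  have herr : ∀ y ∈ Ico (0 : ℝ) 1, ∀ n : ℕ, f^[n + 1] (φ y) - φ ((rotMap ρ)^[n + 1] y)
      = lam ^ n * (f (φ y) - φ (rotMap ρ y)) := by
    intro y hy n
    induction n with
    | zero => simp
    | succ n ih =>
      rw [Function.iterate_succ_apply', Function.iterate_succ_apply' (rotMap ρ), hf, hφ,
        pcMap_sub_phiFun_rotMap hlam hd hδ hρ hα hη ?_ (hrot y hy _) (h y hy _).1 (h y hy _).2,
        ← hf, ← hφ, ih]
      · ring
      · rw [Function.iterate_succ_apply']
        exact pcMap_mem _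
  have hIcc : ∀ z ∈ Ico (0 : ℝ) 1, φ z ∈ Icc (0 : ℝ) 1 := by
    intro z hz
    -- Follow an (n+1)-fold rotation preimage of z. The initial error is bounded since φ takes [0,1)
    -- into [φ(0), φ(0) + 1].
    have hbd : ∀ n : ℕ, ∃ x ∈ Ico (0 : ℝ) 1, |x - φ z| ≤ lam ^ n * (|φ 0| + 2) := by
      intro n
      set y := Int.fract (z - ((n + 1 : ℕ) : ℝ) * ρ) with hy
      have hy' : y ∈ Ico (0 : ℝ) 1 := ⟨Int.fract_nonneg _, Int.fract_lt_one _⟩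
      have hz' : (rotMap ρ)^[n + 1] y = z := by
        rw [hy, iterate_rotMap_fract, sub_add_cancel, Int.fract_eq_self.2 hz]
      refine ⟨f^[n + 1] (φ y), ?_, ?_⟩
      · rw [Function.iterate_succ_apply']
        exact pcMap_mem _
      · have h1 := herr y hy' n
        rw [hz'] at h1
        rw [h1, abs_mul, abs_of_nonneg (pow_nonneg hlam.1.le n)]
        refine mul_le_mul_of_nonneg_left ?_ (pow_nonneg hlam.1.le n)
        have h2 := pcMap_mem (lam := lam) (d := d) (δ := δ) (a := a) (φ y)
        rw [← hf] at h2
        have h3 := hmono (rotMap_mem (ρ := ρ) y).1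
        have h4 := hmono (rotMap_mem (ρ := ρ) y).2.le
        rw [abs_le]
        constructor <;> cases abs_cases (φ 0) <;> linarith [h2.1, h2.2]
    have hlim : Tendsto (fun n : ℕ => lam ^ n * (|φ 0| + 2)) atTop (𝓝 0) := by
      simpa using (tendsto_pow_atTop_nhds_zero_of_lt_one hlam.1.le hlam.2).mul_const (|φ 0| + 2)
    constructor
    · have h1 : Tendsto (fun n : ℕ => φ z + lam ^ n * (|φ 0| + 2)) atTop (𝓝 (φ z)) := by
        simpa using hlim.const_add (φ z)
      refine ge_of_tendsto' h1 fun n => ?_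
      obtain ⟨x, hx, hx'⟩ := hbd n
      linarith [(abs_le.1 hx').2, hx.1]
    · have h1 : Tendsto (fun n : ℕ => φ z - lam ^ n * (|φ 0| + 2)) atTop (𝓝 (φ z)) := by
        simpa using hlim.const_sub (φ z)
      refine le_of_tendsto' h1 fun n => ?_
      obtain ⟨x, hx, hx'⟩ := hbd n
      linarith [(abs_le.1 hx').1, hx.2]
  have hne : ∀ z ∈ Ico (0 : ℝ) 1, φ z ≠ 1 := by
    intro z hz h1
    by_cases hirr : Irrational ρ
    · have h2 : z < (z + 1) / 2 := by linarith [hz.2]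
      have h3 := phiFun_strictMono (δ := δ) hlam hd hα hirr h2
      have h4 := (hIcc ((z + 1) / 2) ⟨by linarith [hz.1], by linarith [hz.2]⟩).2
      rw [← hφ] at h3
      linarith
    obtain ⟨p, q, hq, hpq⟩ := exists_mul_eq_of_not_irrational hirr
    obtain ⟨n, rfl⟩ := Nat.exists_eq_add_of_lt hq
    rw [zero_add] at hpq
    have hz' : (rotMap ρ)^[n + 1] z = z := by
      rw [iterate_rotMap hz, hpq, Int.fract_add_intCast, Int.fract_eq_self.2 hz]
    have h2 := herr z hz n
    have h3 : f^[n + 1] (φ z) < 1 := by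
      rw [Function.iterate_succ_apply']
      exact (pcMap_mem _).2
    rw [hz', h1] at h2
    rw [h1] at h3
    -- Now z is periodic for the rotation, and the error on its return is f^(n+1)(1) - 1 < 0. So
    -- f(1) < φ(R z) = λ + δ + d - 1 < δ, whereas f(1), computed at 0 by periodicity, is at least δ
    -- unless δ + d overflows.
    have h4 : f 1 - φ (rotMap ρ z) < 0 := by
      by_contra! h5
      have := mul_nonneg (pow_nonneg hlam.1.le n) h5
      linarith
    have h5 := h z hz 0
    simp only [Function.iterate_zero, id_eq] at h5
    rw [← hφ, h1, stepTheta_of_le ha.2, stepTheta_of_le hη1] at h5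
    have h6 : φ (rotMap ρ z) = lam + δ + d - 1 := by
      have e2 : stepTheta 1 (z + ρ) = 1 := by
        rw [← stepTheta_eq_stepTheta_iff.2 (sub_le_iff_le_add (a := 1) (b := z) (c := ρ)), ← h5.2]
      rw [rotMap, fract_of_mem_Ico_two ⟨by linarith [hz.1, hρ.1], by linarith [hz.2, hρ.2]⟩, e2]
      have h7 := phiFun_add_int (δ := δ) (ρ := ρ) hlam hd hα (z + ρ - 1) 1
      rw [Int.cast_one, sub_add_cancel, phiFun_add hlam hd hα, psiFun, Int.floor_eq_zero_iff.2 hz,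
        Int.fract_eq_self.2 hz, ← h5.1, ← hφ, h1] at h7
      push_cast at h7
      linarith
    have h7 : f 1 = Int.fract (δ + d * stepTheta a 0) := by
      have e := pcMap_add_int (lam := lam) (d := d) (δ := δ) (a := a) 0 1
      rw [Int.cast_one, zero_add] at e
      rw [hf, e, pcMap, liftMap_of_mem ⟨le_rfl, one_pos⟩]
      simp
    rcases lt_or_ge (δ + d * stepTheta a 0) 1 with h8 | h8
    · have h9 : 0 ≤ d * stepTheta a 0 := by
        refine mul_nonneg hd.1.le ?_
        unfold stepTheta; split_ifs <;> norm_num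
      have h10 : 0 < δ := by linarith [hδ.1, hd.2]
      rw [Int.fract_eq_self.2 ⟨by linarith, h8⟩] at h7
      linarith [hd.2]
    · rcases lt_or_ge 0 a with h9 | h9
      · rw [stepTheta_of_lt h9] at h8
        linarith [hδ.2]
      · have ha0 : a = 0 := le_antisymm h9 ha.1
        rw [stepTheta_of_le h9, mul_one] at h8
        have h10 := (h 0 ⟨le_rfl, one_pos⟩ 0).1
        simp only [Function.iterate_zero, id_eq] at h10
        rw [stepTheta_eq_stepTheta_iff] at h10
        have h11 := h10.1 (h9.trans (hIcc 0 ⟨le_rfl, one_pos⟩).1)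
        exact (h0 ha0 h8).not_ge h11
  refine isCompatible_of_forall_Ico hlam hd ha hα fun y hy =>
    ⟨⟨(hIcc y hy).1, (hIcc y hy).2.lt_of_ne (hne y hy)⟩, ?_⟩
  exact stepTheta_eq_stepTheta_iff.1 (h y hy 0).1

theorem codingCondition_iff (hlam : lam ∈ Ioo (0 : ℝ) 1)
    (hd : d ∈ Ioo (0 : ℝ) (1 - lam)) (hδ : δ ∈ Ioo (1 - lam - d) 1) (ha : a ∈ Icc (0 : ℝ) 1)
    (hρ : ρ ∈ Ioo (0 : ℝ) 1) (hα : α ∈ Icc (0 : ℝ) 1) :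
    CodingCondition lam d δ a ρ α ↔ IsCompatible lam d δ a ρ α := by
  refine ⟨?_, fun h => h.codingCondition hlam hd hδ ha hρ hα⟩
  rintro (⟨h1, -, h⟩ | ⟨h1, rfl, h⟩ | ⟨h1, -, h⟩)
  · refine isCompatible_of_sameCodes hlam hd hδ ha hρ hα
      (fun x hx => one_le_liftMap_iff_etaOne hlam.1 h1.2.2.le hd.1 hx) ?_ ?_ h
    · rw [etaOne, div_le_one hlam.1]
      linarith [hδ.1]
    · rintro - h2
      have := h1.1.2
      simp only at this
      linarith
  · refine isCompatible_of_sameCodes hlam hd hδ ha hρ hα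
      (fun x hx => one_le_liftMap_iff_self hlam.1 h1.2.2 hx) ha.2 ?_ h
    intros
    linarith [hρ.2]
  · refine isCompatible_of_sameCodes hlam hd hδ ha hρ hα
      (fun x hx => one_le_liftMap_iff_etaTwo hlam.1 hd.1 h1.2.1 hx) (h1.2.1.le.trans ha.2) ?_ h
    rintro rfl -
    have h3 : etaTwo lam δ < 0 := h1.2.1
    have h4 : 0 < etaTwo lam δ := div_pos (by linarith [hδ.2]) hlam.1
    linarith

/-! ### The attractor and its backward orbits -/

theorem IsCompatible.image_subset_attractor (hlam : lam ∈ Ioo (0 : ℝ) 1)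
    (hd : d ∈ Ioo (0 : ℝ) (1 - lam)) (ha : a ∈ Icc (0 : ℝ) 1) (hα : α ∈ Icc (0 : ℝ) 1)
    (h : IsCompatible lam d δ a ρ α) :
    phiFun lam d δ ρ α '' Ico 0 1 ⊆ attractor lam d δ a := by
  rintro _ ⟨y, hy, rfl⟩
  refine mem_iInter.2 fun n => ⟨phiFun lam d δ ρ α (Int.fract (y - n * ρ)),
    (h.phiFun_mem_iff hlam hd hα).2 ⟨Int.fract_nonneg _, Int.fract_lt_one _⟩, ?_⟩
  rw [h.iterate_pcMap_phiFun hlam hd ha hα, iterate_rotMap_fract, sub_add_cancel,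
    Int.fract_eq_self.2 hy]

theorem iterate_liftMap_add_int (n : ℕ) (x : ℝ) (m : ℤ) :
    (liftMap lam d δ a)^[n] (x + m) = (liftMap lam d δ a)^[n] x + m := by
  induction n with
  | zero => rfl
  | succ n ih => rw [Function.iterate_succ_apply', ih, liftMap_add_int,
      Function.iterate_succ_apply' (liftMap lam d δ a)]

theorem exists_iterate_liftMap_eq (n : ℕ) (x : ℝ) :
    ∃ m : ℤ, (liftMap lam d δ a)^[n] x = (pcMap lam d δ a)^[n] x + m := by
  induction n with
  | zero => exact ⟨0, by simp⟩
  | succ n ih =>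
    obtain ⟨m, hm⟩ := ih
    refine ⟨⌊liftMap lam d δ a ((pcMap lam d δ a)^[n] x)⌋ + m, ?_⟩
    rw [Function.iterate_succ_apply', hm, liftMap_add_int,
      Function.iterate_succ_apply' (pcMap lam d δ a), pcMap, Int.cast_add, ← add_assoc,
      Int.fract_add_floor]

/-- Points of the attractor have backward orbits for the lift. -/
theorem exists_backward_orbit (hlam : lam ∈ Ioo (0 : ℝ) 1)
    (hd : d ∈ Ioo (0 : ℝ) (1 - lam)) (ha : a ∈ Icc (0 : ℝ) 1) {x : ℝ}
    (hx : x ∈ attractor lam d δ a) :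
    ∃ X : ℕ → ℝ, X 0 = x ∧ ∀ n, liftMap lam d δ a (X (n + 1)) = X n := by
  have h : ∀ n, ∃ z, (liftMap lam d δ a)^[n] z = x := by
    intro n
    obtain ⟨u, -, hu⟩ := mem_iInter.1 hx n
    obtain ⟨m, hm⟩ := exists_iterate_liftMap_eq (lam := lam) (d := d) (δ := δ) (a := a) n u
    refine ⟨u + (-m : ℤ), ?_⟩
    rw [iterate_liftMap_add_int, hm, hu]
    push_cast; ring
  choose X hX using h
  refine ⟨X, hX 0, fun n => ?_⟩
  -- The preimages were chosen independently; injectivity of F^n makes them cohere into one orbit.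
  apply (liftMap_strictMono (δ := δ) hlam hd ha).injective.iterate n
  rw [hX n, ← Function.iterate_succ_apply, hX]

/-- Take y = sup {z | φ(z) ≤ x}; right continuity gives the upper bound. -/
theorem exists_sandwich (hlam : lam ∈ Ioo (0 : ℝ) 1) (hd : d ∈ Ioo (0 : ℝ) (1 - lam))
    (hα : α ∈ Icc (0 : ℝ) 1) (x : ℝ) :
    ∃ y, (∀ z < y, phiFun lam d δ ρ α z ≤ x) ∧ x ≤ phiFun lam d δ ρ α y := by
  have hmono := phiFun_mono (δ := δ) (ρ := ρ) hlam hd hα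
  have hint : ∀ m : ℤ, phiFun lam d δ ρ α m = phiFun lam d δ ρ α 0 + m := fun m => by
    rw [← phiFun_add_int hlam hd hα, zero_add]
  set S := {z | phiFun lam d δ ρ α z ≤ x} with hS
  have hne : S.Nonempty := by
    refine ⟨(⌊x - phiFun lam d δ ρ α 0⌋ : ℤ), ?_⟩
    rw [hS, mem_ofPred_eq, hint]
    linarith [Int.floor_le (x - phiFun lam d δ ρ α 0)]
  have hbdd : BddAbove S := by
    refine ⟨(⌊x - phiFun lam d δ ρ α 0⌋ + 1 : ℤ), fun z hz => ?_⟩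
    by_contra! h
    have h1 := (hmono h.le).trans hz
    rw [hint] at h1
    push_cast at h1
    linarith [Int.lt_floor_add_one (x - phiFun lam d δ ρ α 0)]
  refine ⟨sSup S, fun z hz => ?_, ?_⟩
  · obtain ⟨w, hw, hzw⟩ := exists_lt_of_lt_csSup hne hz
    exact (hmono hzw.le).trans hw
  · refine ge_of_tendsto ((tendsto_phiFun_nhdsGE hlam hd hα (sSup S)).mono_left
      (nhdsWithin_mono _ Ioi_subset_Ici_self)) ?_
    filter_upwards [self_mem_nhdsWithin] with z hz
    by_contra! h
    exact (not_le.2 hz) (le_csSup hbdd h.le)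

theorem ceil_sub_one_eq_floor {w : ℝ} (h : ∀ m : ℤ, w ≠ m) : ⌈w⌉ - 1 = ⌊w⌋ := by
  have h1 := (Int.floor_le w).lt_of_ne (h _).symm
  have : ⌈w⌉ = ⌊w⌋ + 1 := by
    rw [Int.ceil_eq_iff]
    push_cast
    exact ⟨by linarith, (Int.lt_floor_add_one w).le⟩
  omega

namespace IsCompatible

variable {X : ℕ → ℝ} {y : ℝ}

/-- F is strictly increasing and carries φ(z) to φ(z + ρ), so both inequalities pull back. -/
theorem sandwich (hlam : lam ∈ Ioo (0 : ℝ) 1) (hd : d ∈ Ioo (0 : ℝ) (1 - lam))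
    (ha : a ∈ Icc (0 : ℝ) 1) (hα : α ∈ Icc (0 : ℝ) 1) (h : IsCompatible lam d δ a ρ α)
    (hX : ∀ n, liftMap lam d δ a (X (n + 1)) = X n)
    (h1 : ∀ z < y, phiFun lam d δ ρ α z ≤ X 0) (h2 : X 0 ≤ phiFun lam d δ ρ α y) (n : ℕ) :
    (∀ z < y - n * ρ, phiFun lam d δ ρ α z ≤ X n) ∧ X n ≤ phiFun lam d δ ρ α (y - n * ρ) := by
  have hF := liftMap_strictMono (δ := δ) hlam hd ha
  induction n with
  | zero => simpa using ⟨h1, h2⟩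
  | succ n ih =>
    push_cast
    constructor
    · intro z hz
      rw [← hF.le_iff_le, hX, h.liftMap_phiFun hlam hd ha hα]
      exact ih.1 _ (by linarith)
    · rw [← hF.le_iff_le, hX, h.liftMap_phiFun hlam hd ha hα]
      rw [show y - (n + 1) * ρ + ρ = y - n * ρ by ring]
      exact ih.2

theorem floor_sandwich (hlam : lam ∈ Ioo (0 : ℝ) 1) (hd : d ∈ Ioo (0 : ℝ) (1 - lam))
    (hα : α ∈ Icc (0 : ℝ) 1) (h : IsCompatible lam d δ a ρ α) {x w : ℝ}
    (h1 : ∀ z < w, phiFun lam d δ ρ α z ≤ x) (h2 : x ≤ phiFun lam d δ ρ α w) :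
    (⌈w⌉ - 1 ≤ ⌊x⌋ ∧ ⌊x⌋ ≤ ⌊w⌋) ∧ (⌈w - α⌉ - 1 ≤ ⌊x - a⌋ ∧ ⌊x - a⌋ ≤ ⌊w - α⌋) := by
  obtain ⟨z, ⟨hz1, hz2⟩, hz⟩ := ((eventually_floor_left α w).and self_mem_nhdsWithin).exists
  rw [← hz1, ← hz2, ← h.floor_phiFun hlam hd hα z, ← h.floor_phiFun hlam hd hα w,
    ← h.floor_phiFun_sub hlam hd hα z, ← h.floor_phiFun_sub hlam hd hα w]
  have h3 := h1 z hz
  exact ⟨⟨Int.floor_mono h3, Int.floor_mono h2⟩, Int.floor_mono (by linarith),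
    Int.floor_mono (by linarith)⟩

/-- A backward orbit which stays close to that of `phiFun u` and eventually has the same symbols
coincides with it. -/
theorem eq_phiFun_of_floor_eq (hlam : lam ∈ Ioo (0 : ℝ) 1) (hd : d ∈ Ioo (0 : ℝ) (1 - lam))
    (ha : a ∈ Icc (0 : ℝ) 1) (hα : α ∈ Icc (0 : ℝ) 1) (h : IsCompatible lam d δ a ρ α)
    (hX : ∀ n, liftMap lam d δ a (X (n + 1)) = X n) {u : ℝ}
    (hb : ∀ n : ℕ, |X n - phiFun lam d δ ρ α (u - n * ρ)| ≤ 1) {N : ℕ}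
    (hN : ∀ n ≥ N, ⌊X n⌋ = ⌊u - n * ρ⌋ ∧ ⌊X n - a⌋ = ⌊u - n * ρ - α⌋) :
    X 0 = phiFun lam d δ ρ α u := by
  have hstep : ∀ n : ℕ, liftMap lam d δ a (phiFun lam d δ ρ α (u - (n + 1 : ℕ) * ρ))
      = phiFun lam d δ ρ α (u - n * ρ) := fun n => by
    rw [h.liftMap_phiFun hlam hd ha hα]
    congr 1; push_cast; ring
  -- With equal floors both points lie on the same affine piece of slope λ, so a bounded difference
  -- in the remote past forces equality at time N.
  have hcontr : ∀ k : ℕ, X N - phiFun lam d δ ρ α (u - N * ρ)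
      = lam ^ k * (X (N + k) - phiFun lam d δ ρ α (u - (N + k : ℕ) * ρ)) := by
    intro k
    induction k with
    | zero => simp
    | succ k ih =>
      obtain ⟨h1, h2⟩ := hN (N + (k + 1)) (by omega)
      rw [ih, ← hX (N + k), ← hstep (N + k), liftMap_eq, liftMap_eq, psiFun_eq ha, psiFun_eq ha,
        h.floor_phiFun hlam hd hα, h.floor_phiFun_sub hlam hd hα, add_assoc N k 1, h1, h2]
      ring
  have hzero : |X N - phiFun lam d δ ρ α (u - N * ρ)| ≤ 0 := by
    refine ge_of_tendsto' (tendsto_pow_atTop_nhds_zero_of_lt_one hlam.1.le hlam.2) fun k => ?_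
    rw [hcontr k, abs_mul, abs_of_nonneg (pow_nonneg hlam.1.le k)]
    exact mul_le_of_le_one_right (pow_nonneg hlam.1.le k) (hb _)
  have hdown : ∀ n : ℕ, X n = phiFun lam d δ ρ α (u - n * ρ) → X 0 = phiFun lam d δ ρ α u := by
    intro n
    induction n with
    | zero => simp
    | succ n ih =>
      intro hn
      refine ih ?_
      rw [← hX, hn, hstep]
  exact hdown N (sub_eq_zero.1 (abs_nonpos_iff.1 hzero))

theorem attractor_subset_of_irrational (hlam : lam ∈ Ioo (0 : ℝ) 1)
    (hd : d ∈ Ioo (0 : ℝ) (1 - lam)) (ha : a ∈ Icc (0 : ℝ) 1) (hα : α ∈ Icc (0 : ℝ) 1)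
    (h : IsCompatible lam d δ a ρ α) (hρ : Irrational ρ) :
    attractor lam d δ a ⊆ phiFun lam d δ ρ α '' Ico 0 1 := by
  intro x hx
  obtain ⟨X, rfl, hX⟩ := exists_backward_orbit hlam hd ha hx
  obtain ⟨y, h1, h2⟩ := exists_sandwich (δ := δ) (ρ := ρ) hlam hd hα (X 0)
  have hs := h.sandwich hlam hd ha hα hX h1 h2
  -- Two integer hits would make a nonzero multiple of ρ an integer.
  have hev : ∀ v : ℝ, ∃ N : ℕ, ∀ n ≥ N, ∀ m : ℤ, v - n * ρ ≠ m := by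
    intro v
    by_cases hv : ∃ (k : ℕ) (m : ℤ), v - k * ρ = m
    · obtain ⟨k, m, hk⟩ := hv
      refine ⟨k + 1, fun n hn m' hn' => ?_⟩
      have h3 := (hρ.natCast_mul (m := n - k) (by omega)).ne_int (m - m')
      apply h3
      rw [Nat.cast_sub (by omega)]
      push_cast
      linarith
    · push Not at hv
      exact ⟨0, fun n _ m => hv n m⟩
  obtain ⟨N₁, hN₁⟩ := hev y
  obtain ⟨N₂, hN₂⟩ := hev (y - α)
  have hxy : X 0 = phiFun lam d δ ρ α y := by
    refine h.eq_phiFun_of_floor_eq hlam hd ha hα hX (fun n => ?_) (N := max N₁ N₂) fun n hn => ?_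
    · obtain ⟨h3, h4⟩ := hs n
      have h5 := h3 (y - n * ρ + (-1 : ℤ)) (by push_cast; linarith)
      rw [phiFun_add_int hlam hd hα] at h5
      push_cast at h5
      rw [abs_le]; constructor <;> linarith
    · have h3 := h.floor_sandwich hlam hd hα (hs n).1 (hs n).2
      have h4 := ceil_sub_one_eq_floor (hN₁ n ((le_max_left _ _).trans hn))
      have h5 := ceil_sub_one_eq_floor (hN₂ n ((le_max_right _ _).trans hn))
      rw [sub_right_comm] at h5
      omega
  have hmem : X 0 ∈ Ico (0 : ℝ) 1 := by
    simpa using mem_iInter.1 hx 0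
  exact ⟨y, (h.phiFun_mem_iff hlam hd hα).1 (hxy ▸ hmem), hxy.symm⟩

end IsCompatible

/-! ### The attractor for rational rotation number -/

/-- `C` marks the ambiguous times. If `R` fails once, at an ambiguous time, it fails at all later
times of that class mod `q`; these include every later ambiguous time, so `L` holds from there on.
-/
theorem eventually_or_eventually_of_modEq {q : ℕ} {C R L : ℕ → Prop} (hRL : ∀ n, R n ∨ L n)
    (hC : ∀ n, ¬ C n → R n ∧ L n) (hmod : ∀ i j, C i → C j → i ≡ j [MOD q])
    (h : ∀ n, ¬ R n → ¬ R (n + q)) : (∃ N, ∀ n ≥ N, R n) ∨ ∃ N, ∀ n ≥ N, L n := by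
  by_cases hR : ∀ n, R n
  · exact Or.inl ⟨0, fun n _ => hR n⟩
  push Not at hR
  obtain ⟨i, hi⟩ := hR
  refine Or.inr ⟨i, fun n hn => ?_⟩
  by_cases hn' : C n
  · have hi' : C i := by
      by_contra h'
      exact hi (hC i h').1
    obtain ⟨t, ht⟩ := (Nat.modEq_iff_dvd' hn).1 (hmod i n hi' hn')
    have hit : ∀ t, ¬ R (i + q * t) := by
      intro t
      induction t with
      | zero => simpa using hi
      | succ t ih => rw [Nat.mul_succ, ← add_assoc]; exact h _ ih
    have e : n = i + q * t := by omega
    exact (hRL n).resolve_left (e ▸ hit t)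
  · exact (hC n hn').2

namespace IsCompatible

theorem attractor_subset_of_rational (hlam : lam ∈ Ioo (0 : ℝ) 1)
    (hd : d ∈ Ioo (0 : ℝ) (1 - lam)) (ha : a ∈ Icc (0 : ℝ) 1) (hα : α ∈ Icc (0 : ℝ) 1)
    (h : IsCompatible lam d δ a ρ α) {p q : ℕ} (hq : 0 < q) (hpq : Nat.Coprime p q)
    (hρ : q * ρ = p) (hαq : ∀ j : ℤ, q * α ≠ j) :
    attractor lam d δ a ⊆ phiFun lam d δ ρ α '' Ico 0 1 := by
  intro x hx
  have hF := liftMap_strictMono (δ := δ) hlam hd ha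
  have hmono := phiFun_mono (δ := δ) (ρ := ρ) hlam hd hα
  obtain ⟨X, rfl, hX⟩ := exists_backward_orbit hlam hd ha hx
  obtain ⟨y, h1, h2⟩ := exists_sandwich (δ := δ) (ρ := ρ) hlam hd hα (X 0)
  have hs := h.sandwich hlam hd ha hα hX h1 h2
  have hfl := fun n => h.floor_sandwich hlam hd hα (hs n).1 (hs n).2
  have hmem : X 0 ∈ Ico (0 : ℝ) 1 := by
    simpa using mem_iInter.1 hx 0
  suffices hu : ∃ u, X 0 = phiFun lam d δ ρ α u by
    obtain ⟨u, hu⟩ := hu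
    exact ⟨u, (h.phiFun_mem_iff hlam hd hα).1 (hu ▸ hmem), hu.symm⟩
  have hper : ∀ n : ℕ, y - (n + q : ℕ) * ρ = y - n * ρ - (p : ℤ) := fun n => by
    push_cast; rw [← hρ]; ring
  -- `R n` and `L n`: the symbols are those at the point `y - n ρ` itself, resp. on its left.
  set R : ℕ → Prop := fun n => ⌊X n⌋ = ⌊y - n * ρ⌋ ∧ ⌊X n - a⌋ = ⌊y - n * ρ - α⌋ with hR
  set L : ℕ → Prop := fun n => ⌊X n⌋ = ⌈y - n * ρ⌉ - 1 ∧ ⌊X n - a⌋ = ⌈y - n * ρ - α⌉ - 1 with hL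
  set C : ℕ → Prop := fun n => (∃ m : ℤ, y - n * ρ = m) ∨ ∃ m : ℤ, y - n * ρ - α = m with hC
  -- As qα is not an integer, one rotation orbit cannot meet both kinds of discontinuity; this keeps
  -- ambiguous times in a single class mod q.
  have hexcl : ∀ i j : ℕ, (∃ m : ℤ, y - i * ρ = m) → (∃ m : ℤ, y - j * ρ - α = m) → False := by
    rintro i j ⟨m, hm⟩ ⟨m', hm'⟩
    apply hαq (q * m - q * m' + (i - j) * p)
    push_cast
    rw [← hm, ← hm', ← hρ]; ring
  have hmod' : ∀ i j : ℕ, (∃ m : ℤ, (i : ℝ) * ρ - j * ρ = m) → i ≡ j [MOD q] := by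
    rintro i j ⟨m, hm⟩
    have h3 : ((i : ℤ) - j) * p = q * m := by
      have : ((i : ℝ) - j) * p = q * m := by rw [← hm, ← hρ]; ring
      exact_mod_cast this
    refine (Int.natCast_modEq_iff.1 (Int.modEq_iff_dvd.2 ?_)).symm
    exact (Nat.isCoprime_iff_coprime.2 hpq.symm).dvd_of_dvd_mul_right ⟨m, h3⟩
  have hmod : ∀ i j, C i → C j → i ≡ j [MOD q] := by
    rintro i j (⟨m, hm⟩ | ⟨m, hm⟩) (⟨m', hm'⟩ | ⟨m', hm'⟩)
    · exact hmod' i j ⟨m' - m, by push_cast; linarith⟩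
    · exact (hexcl i j ⟨m, hm⟩ ⟨m', hm'⟩).elim
    · exact (hexcl j i ⟨m', hm'⟩ ⟨m, hm⟩).elim
    · exact hmod' i j ⟨m' - m, by push_cast; linarith⟩
  have hCRL : ∀ n, ¬ C n → R n ∧ L n := by
    intro n hn
    simp only [hC, not_or, not_exists] at hn
    have h3 := ceil_sub_one_eq_floor hn.1
    have h4 := ceil_sub_one_eq_floor hn.2
    have h5 := hfl n
    simp only [hR, hL]
    omega
  have hRL : ∀ n, R n ∨ L n := by
    intro n
    have h5 := hfl n
    have h6 := Int.floor_le_ceil (y - n * ρ)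
    by_cases h3 : ∃ m : ℤ, y - n * ρ = m
    · have h4 := ceil_sub_one_eq_floor (w := y - n * ρ - α)
        fun m hm => hexcl n n h3 ⟨m, hm⟩
      obtain ⟨m, hm⟩ := h3
      have h7 : ⌈y - n * ρ⌉ = ⌊y - n * ρ⌋ := by rw [hm]; simp
      simp only [hR, hL]
      omega
    · have h4 := ceil_sub_one_eq_floor (not_exists.1 h3)
      have h7 := Int.ceil_le_floor_add_one (y - n * ρ - α)
      by_cases h8 : ∃ m : ℤ, y - n * ρ - α = m
      · obtain ⟨m, hm⟩ := h8
        have h7 : ⌈y - n * ρ - α⌉ = ⌊y - n * ρ - α⌋ := by rw [hm]; simp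
        simp only [hR, hL]
        omega
      · have h9 := ceil_sub_one_eq_floor (not_exists.1 h8)
        simp only [hR, hL]
        omega
  -- The order of X (n + q) + p and X n is the same for all n because F is increasing. It forbids
  -- switching from one side to the other as n grows by q.
  have hRLev : (∃ N, ∀ n ≥ N, R n) ∨ ∃ N, ∀ n ≥ N, L n := by
    rcases le_total (X q + (p : ℤ)) (X 0) with hle | hle
    · have hall : ∀ n, X (n + q) + (p : ℤ) ≤ X n := by
        intro n
        induction n with
        | zero => simpa using hle
        | succ n ih =>
          rw [← hF.le_iff_le, liftMap_add_int, hX, show n + 1 + q = n + q + 1 by ring, hX]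
          exact ih
      refine eventually_or_eventually_of_modEq hRL hCRL hmod fun n => mt fun hn => ?_
      obtain ⟨h3, h4⟩ := hn
      have h5 := hfl n
      rw [hper] at h3 h4
      rw [sub_right_comm] at h4
      rw [Int.floor_sub_intCast] at h3 h4
      have h6 := Int.floor_mono (hall n)
      have h7 := Int.floor_mono (sub_le_sub_right (hall n) a)
      rw [add_sub_right_comm] at h7
      rw [Int.floor_add_intCast] at h6 h7
      simp only [hR]
      omega
    · have hall : ∀ n, X n ≤ X (n + q) + (p : ℤ) := by
        intro n
        induction n with
        | zero => simpa using hle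
        | succ n ih =>
          rw [← hF.le_iff_le, liftMap_add_int, hX, show n + 1 + q = n + q + 1 by ring, hX]
          exact ih
      refine (eventually_or_eventually_of_modEq (fun n => (hRL n).symm)
        (fun n hn => (hCRL n hn).symm) hmod fun n => mt fun hn => ?_).symm
      obtain ⟨h3, h4⟩ := hn
      have h5 := hfl n
      rw [hper] at h3 h4
      rw [sub_right_comm] at h4
      rw [Int.ceil_sub_intCast] at h3 h4
      have h6 := Int.floor_mono (hall n)
      have h7 := Int.floor_mono (sub_le_sub_right (hall n) a)
      rw [add_sub_right_comm] at h7
      rw [Int.floor_add_intCast] at h6 h7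
      simp only [hL]
      omega
  rcases hRLev with ⟨N, hN⟩ | ⟨N, hN⟩
  · refine ⟨y, h.eq_phiFun_of_floor_eq hlam hd ha hα hX (fun n => ?_) hN⟩
    obtain ⟨h3, h4⟩ := hs n
    have h5 := h3 (y - n * ρ + (-1 : ℤ)) (by push_cast; linarith)
    rw [phiFun_add_int hlam hd hα] at h5
    push_cast at h5
    rw [abs_le]; constructor <;> linarith
  -- Left symbols along the whole orbit are the symbols of a point z just to the left of y.
  · obtain ⟨z, hz, hzy⟩ := ((eventually_forall_floor_left hq (p := p) (by exact_mod_cast hρ) α y).and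
      (Ioo_mem_nhdsLT (sub_one_lt y))).exists
    refine ⟨z, h.eq_phiFun_of_floor_eq hlam hd ha hα hX (fun n => ?_)
      fun n hn => ⟨(hN n hn).1.trans (hz n).1.symm, (hN n hn).2.trans (hz n).2.symm⟩⟩
    obtain ⟨h3, h4⟩ := hs n
    have h5 := h3 (z - n * ρ) (by linarith [hzy.2])
    have h6 : phiFun lam d δ ρ α (y - n * ρ) ≤ phiFun lam d δ ρ α (z - n * ρ + (1 : ℤ)) :=
      hmono (by push_cast; linarith [hzy.1])
    rw [phiFun_add_int hlam hd hα] at h6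
    push_cast at h6
    rw [abs_le]; constructor <;> linarith

end IsCompatible

/-! ### Periodic orbits for ρ = p/q -/

theorem exists_nat_mul_eq_of_coprime {p q : ℕ} (hq : 0 < q) (hpq : Nat.Coprime p q)
    (hρ : q * ρ = p) (j : ℤ) : ∃ (k : ℕ) (m : ℤ), 0 < k ∧ (j : ℝ) / q - k * ρ = m := by
  obtain ⟨u, v, huv⟩ := Nat.isCoprime_iff_coprime.2 hpq
  have hq' : (0 : ℝ) < q := by exact_mod_cast hq
  -- The Bézout coefficient ju is shifted by a multiple of q to become positive, since φ only jumps
  -- at m + kρ with k ≥ 1.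
  have hk : 0 < j * u + q * (|j * u| + 1) := by
    have h1 : (1 : ℤ) ≤ q := by exact_mod_cast hq
    have h2 := neg_abs_le (j * u)
    nlinarith [abs_nonneg (j * u)]
  obtain ⟨k, hk'⟩ := Int.eq_ofNat_of_zero_le hk.le
  refine ⟨k, j * v - (|j * u| + 1) * p, by omega, ?_⟩
  have h1 : (k : ℤ) * p = j - q * (j * v - (|j * u| + 1) * p) := by
    rw [← hk']
    linear_combination j * huv
  have h2 : (k : ℝ) * p = j - q * ((j * v - (|j * u| + 1) * p : ℤ) : ℝ) := by exact_mod_cast h1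
  rw [← hρ] at h2
  have h3 : (q : ℝ) * (j / q - k * ρ - ((j * v - (|j * u| + 1) * p : ℤ) : ℝ)) = 0 := by
    rw [mul_sub, mul_sub, mul_div_cancel₀ _ hq'.ne']
    linarith
  exact sub_eq_zero.1 ((mul_eq_zero.1 h3).resolve_left hq'.ne')

theorem phiFun_lt_phiFun_of_div (hlam : lam ∈ Ioo (0 : ℝ) 1) (hd : d ∈ Ioo (0 : ℝ) (1 - lam))
    (hα : α ∈ Icc (0 : ℝ) 1) {p q : ℕ} (hq : 0 < q) (hpq : Nat.Coprime p q)
    (hρ : q * ρ = p) {u v : ℝ} {j : ℤ} (hu : u < j / q) (hv : j / q ≤ v) :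
    phiFun lam d δ ρ α u < phiFun lam d δ ρ α v := by
  obtain ⟨k, m, hk, hm⟩ := exists_nat_mul_eq_of_coprime hq hpq hρ j
  exact phiFun_lt_phiFun hlam hd hα hu hv ⟨k, m, hk, Or.inl hm⟩

theorem phiFun_lt_phiFun_of_add_le (hlam : lam ∈ Ioo (0 : ℝ) 1) (hd : d ∈ Ioo (0 : ℝ) (1 - lam))
    (hα : α ∈ Icc (0 : ℝ) 1) {p q : ℕ} (hq : 0 < q) (hpq : Nat.Coprime p q)
    (hρ : q * ρ = p) {u v : ℝ} (h : q * u + 1 ≤ q * v) :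
    phiFun lam d δ ρ α u < phiFun lam d δ ρ α v := by
  have hq' : (0 : ℝ) < q := by exact_mod_cast hq
  refine phiFun_lt_phiFun_of_div hlam hd hα hq hpq hρ (j := ⌊q * v⌋) ?_ ?_
  · rw [lt_div_iff₀ hq']
    linarith [Int.lt_floor_add_one (q * v)]
  · rw [div_le_iff₀ hq']
    linarith [Int.floor_le (q * v)]

/-- For `ρ = p / q`, the values of `phiFun` are taken at the points of `ℤ / q` and `α + ℤ / q`. -/
theorem exists_phiFun_eq (hα : α ∈ Icc (0 : ℝ) 1) {p q : ℕ} (hq : 0 < q) (hρ : q * ρ = p) (y : ℝ) :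
    ∃ j : ℤ, phiFun lam d δ ρ α y = phiFun lam d δ ρ α (j / q) ∨
      phiFun lam d δ ρ α y = phiFun lam d δ ρ α (α + j / q) := by
  have hq' : (0 : ℝ) < q := by exact_mod_cast hq
  -- Between the last point of either grid not exceeding y and y itself no floor in the series
  -- changes; t will be the larger of the two grid points.
  have key : ∀ t : ℝ, (⌊q * y⌋ : ℝ) / q ≤ t → α + (⌊q * (y - α)⌋ : ℝ) / q ≤ t → t ≤ y →
      phiFun lam d δ ρ α y = phiFun lam d δ ρ α t := by
    intro t h1 h2 h3
    have h4 : ∀ (v : ℝ) (k : ℕ) (n : ℤ), (n : ℝ) ≤ v - k * ρ →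
        (n : ℝ) + k * ρ ≤ ⌊q * v⌋ / q := by
      intro v k n hn
      rw [le_div_iff₀ hq']
      have h5 : ((q * n + k * p : ℤ) : ℝ) ≤ q * v := by
        push_cast
        rw [← hρ]
        nlinarith
      have h6 : ((q * n + k * p : ℤ) : ℝ) ≤ ⌊q * v⌋ := by exact_mod_cast Int.le_floor.2 h5
      push_cast at h6
      rw [← hρ] at h6
      linarith
    rw [phiFun, phiFun]
    congr 3 with k
    rw [psiFun_eq hα, psiFun_eq hα]
    have e1 : ⌊y - ((k + 1 : ℕ) : ℝ) * ρ⌋ = ⌊t - ((k + 1 : ℕ) : ℝ) * ρ⌋ := by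
      refine eq_of_forall_le_iff fun n => ?_
      rw [Int.le_floor, Int.le_floor]
      exact ⟨fun h => by linarith [h4 y (k + 1) n h], fun h => by linarith⟩
    have e2 : ⌊y - ((k + 1 : ℕ) : ℝ) * ρ - α⌋ = ⌊t - ((k + 1 : ℕ) : ℝ) * ρ - α⌋ := by
      refine eq_of_forall_le_iff fun n => ?_
      rw [Int.le_floor, Int.le_floor]
      exact ⟨fun h => by linarith [h4 (y - α) (k + 1) n (by linarith)], fun h => by linarith⟩
    rw [e1, e2]
  have h1 : (⌊q * y⌋ : ℝ) / q ≤ y := by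
    rw [div_le_iff₀ hq']; linarith [Int.floor_le (q * y)]
  have h2 : α + (⌊q * (y - α)⌋ : ℝ) / q ≤ y := by
    rw [← le_sub_iff_add_le', div_le_iff₀ hq']; linarith [Int.floor_le (q * (y - α))]
  rcases le_total ((⌊q * y⌋ : ℝ) / q) (α + (⌊q * (y - α)⌋ : ℝ) / q) with h | h
  · exact ⟨_, Or.inr (key _ h le_rfl h2)⟩
  · exact ⟨_, Or.inl (key _ le_rfl h h1)⟩

namespace IsCompatible

/-- Modulo 1, adding j/q is rotating k times, and f follows the rotation. -/
theorem exists_iterate_eq (hlam : lam ∈ Ioo (0 : ℝ) 1) (hd : d ∈ Ioo (0 : ℝ) (1 - lam))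
    (ha : a ∈ Icc (0 : ℝ) 1) (hα : α ∈ Icc (0 : ℝ) 1) (h : IsCompatible lam d δ a ρ α)
    {p q : ℕ} (hq : 0 < q) (hpq : Nat.Coprime p q) (hρ : q * ρ = p) {y β : ℝ} {j : ℤ}
    (hy : y ∈ Ico (0 : ℝ) 1) (hβ : β ∈ Ico (0 : ℝ) 1)
    (hj : phiFun lam d δ ρ α y = phiFun lam d δ ρ α (β + j / q)) :
    ∃ k : ℕ, phiFun lam d δ ρ α y = (pcMap lam d δ a)^[k] (phiFun lam d δ ρ α β) := by
  obtain ⟨k, m, -, hm⟩ := exists_nat_mul_eq_of_coprime hq hpq hρ j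
  refine ⟨k, ?_⟩
  rw [h.iterate_pcMap_phiFun hlam hd ha hα, iterate_rotMap hβ, h.phiFun_fract hlam hd hα,
    ← Int.fract_eq_self.2 ((h.phiFun_mem_iff hlam hd hα).2 hy), hj,
    show β + j / q = β + k * ρ + m by linarith, phiFun_add_int hlam hd hα, Int.fract_add_intCast]

theorem iterate_period (hlam : lam ∈ Ioo (0 : ℝ) 1) (hd : d ∈ Ioo (0 : ℝ) (1 - lam))
    (ha : a ∈ Icc (0 : ℝ) 1) (hα : α ∈ Icc (0 : ℝ) 1) (h : IsCompatible lam d δ a ρ α)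
    {p q : ℕ} (hρ : q * ρ = p) {β : ℝ} (hβ : β ∈ Ico (0 : ℝ) 1) :
    Function.IsPeriodicPt (pcMap lam d δ a) q (phiFun lam d δ ρ α β) := by
  rw [Function.IsPeriodicPt, Function.IsFixedPt, h.iterate_pcMap_phiFun hlam hd ha hα,
    iterate_rotMap hβ, hρ, Int.fract_add_natCast, Int.fract_eq_self.2 hβ]

/-- φ separates points at distance at least 1/q. So a period n gives nρ = m for an integer m, and
coprimality gives q ∣ n. -/
theorem minimalPeriod_eq (hlam : lam ∈ Ioo (0 : ℝ) 1) (hd : d ∈ Ioo (0 : ℝ) (1 - lam))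
    (ha : a ∈ Icc (0 : ℝ) 1) (hα : α ∈ Icc (0 : ℝ) 1) (h : IsCompatible lam d δ a ρ α)
    {p q : ℕ} (hq : 0 < q) (hpq : Nat.Coprime p q) (hρ : q * ρ = p) {β : ℝ}
    (hβ : β ∈ Ico (0 : ℝ) 1) :
    Function.minimalPeriod (pcMap lam d δ a) (phiFun lam d δ ρ α β) = q := by
  refine Nat.dvd_antisymm (h.iterate_period hlam hd ha hα hρ hβ).minimalPeriod_dvd ?_
  have hn := Function.iterate_minimalPeriod (f := pcMap lam d δ a) (x := phiFun lam d δ ρ α β)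
  set n := Function.minimalPeriod (pcMap lam d δ a) (phiFun lam d δ ρ α β)
  rw [h.iterate_pcMap_phiFun hlam hd ha hα, iterate_rotMap hβ, h.phiFun_fract hlam hd hα,
    ← Int.self_sub_floor] at hn
  set m := ⌊phiFun lam d δ ρ α (β + n * ρ)⌋
  have h1 : phiFun lam d δ ρ α (β + n * ρ) = phiFun lam d δ ρ α (β + m) := by
    rw [phiFun_add_int hlam hd hα]; linarith
  have h2 : (n : ℤ) * p = q * m := by
    have e : ((n * p : ℤ) : ℝ) = q * (n * ρ) := by push_cast; rw [← hρ]; ring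
    rcases lt_trichotomy ((n : ℤ) * p) (q * m) with h3 | h3 | h3
    · have h4 : (((n : ℤ) * p + 1 : ℤ) : ℝ) ≤ ((q * m : ℤ) : ℝ) :=
        Int.cast_le.2 (Int.add_one_le_of_lt h3)
      rw [Int.cast_add, e] at h4
      push_cast at h4
      exact absurd h1 (phiFun_lt_phiFun_of_add_le hlam hd hα hq hpq hρ (by linarith)).ne
    · exact h3
    · have h4 : ((q * m + 1 : ℤ) : ℝ) ≤ ((n * p : ℤ) : ℝ) :=
        Int.cast_le.2 (Int.add_one_le_of_lt h3)
      rw [e] at h4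
      push_cast at h4
      exact absurd h1 (phiFun_lt_phiFun_of_add_le hlam hd hα hq hpq hρ (by linarith)).ne'
  have h3 : (q : ℤ) ∣ n :=
    (Nat.isCoprime_iff_coprime.2 hpq.symm).dvd_of_dvd_mul_right ⟨m, h2⟩
  exact_mod_cast h3

theorem isPeriodicOrbit_range (hlam : lam ∈ Ioo (0 : ℝ) 1) (hd : d ∈ Ioo (0 : ℝ) (1 - lam))
    (ha : a ∈ Icc (0 : ℝ) 1) (hα : α ∈ Icc (0 : ℝ) 1) (h : IsCompatible lam d δ a ρ α)
    {p q : ℕ} (hq : 0 < q) (hpq : Nat.Coprime p q) (hρ : q * ρ = p) {β : ℝ}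
    (hβ : β ∈ Ico (0 : ℝ) 1) :
    IsPeriodicOrbit (pcMap lam d δ a) q
      (range fun n : ℕ => (pcMap lam d δ a)^[n] (phiFun lam d δ ρ α β)) :=
  ⟨hq, _, (h.phiFun_mem_iff hlam hd hα).2 hβ, h.minimalPeriod_eq hlam hd ha hα hq hpq hρ hβ, rfl⟩

theorem range_subset_image (hlam : lam ∈ Ioo (0 : ℝ) 1) (hd : d ∈ Ioo (0 : ℝ) (1 - lam))
    (ha : a ∈ Icc (0 : ℝ) 1) (hα : α ∈ Icc (0 : ℝ) 1) (h : IsCompatible lam d δ a ρ α) {β : ℝ}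
    (hβ : β ∈ Ico (0 : ℝ) 1) :
    (range fun n : ℕ => (pcMap lam d δ a)^[n] (phiFun lam d δ ρ α β)) ⊆
      phiFun lam d δ ρ α '' Ico 0 1 := by
  rintro _ ⟨n, rfl⟩
  simp only
  rw [h.iterate_pcMap_phiFun hlam hd ha hα, iterate_rotMap hβ]
  exact mem_image_of_mem _ ⟨Int.fract_nonneg _, Int.fract_lt_one _⟩

/-- When α is in ℤ/q the two grids of representatives coincide, so the orbit of φ(0) exhausts the
image. -/
theorem image_isPeriodicOrbit (hlam : lam ∈ Ioo (0 : ℝ) 1) (hd : d ∈ Ioo (0 : ℝ) (1 - lam))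
    (ha : a ∈ Icc (0 : ℝ) 1) (hα : α ∈ Icc (0 : ℝ) 1) (h : IsCompatible lam d δ a ρ α)
    {p q : ℕ} (hq : 0 < q) (hpq : Nat.Coprime p q) (hρ : q * ρ = p)
    (hαq : ∃ i : ℕ, i ≤ q ∧ α = (i : ℝ) / q) :
    IsPeriodicOrbit (pcMap lam d δ a) q (phiFun lam d δ ρ α '' Ico 0 1) := by
  have h0 : (0 : ℝ) ∈ Ico (0 : ℝ) 1 := ⟨le_rfl, one_pos⟩
  convert h.isPeriodicOrbit_range hlam hd ha hα hq hpq hρ h0 using 1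
  refine Subset.antisymm ?_ (h.range_subset_image hlam hd ha hα h0)
  rintro _ ⟨y, hy, rfl⟩
  obtain ⟨i, -, hi⟩ := hαq
  obtain ⟨j, hj⟩ : ∃ j : ℤ, phiFun lam d δ ρ α y = phiFun lam d δ ρ α (0 + j / q) := by
    obtain ⟨j, hj | hj⟩ := exists_phiFun_eq (lam := lam) (d := d) (δ := δ) hα hq hρ y
    · exact ⟨j, by rw [zero_add, hj]⟩
    · refine ⟨i + j, hj.trans (congrArg _ ?_)⟩
      conv_lhs => rw [hi]
      push_cast; ring
  obtain ⟨k, hk⟩ := h.exists_iterate_eq hlam hd ha hα hq hpq hρ hy h0 hj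
  exact ⟨k, hk.symm⟩

theorem image_eq_union (hlam : lam ∈ Ioo (0 : ℝ) 1) (hd : d ∈ Ioo (0 : ℝ) (1 - lam))
    (ha : a ∈ Icc (0 : ℝ) 1) (hα : α ∈ Ico (0 : ℝ) 1) (h : IsCompatible lam d δ a ρ α)
    {p q : ℕ} (hq : 0 < q) (hpq : Nat.Coprime p q) (hρ : q * ρ = p) :
    phiFun lam d δ ρ α '' Ico 0 1 =
      (range fun n : ℕ => (pcMap lam d δ a)^[n] (phiFun lam d δ ρ α 0)) ∪
        range fun n : ℕ => (pcMap lam d δ a)^[n] (phiFun lam d δ ρ α α) := by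
  have h0 : (0 : ℝ) ∈ Ico (0 : ℝ) 1 := ⟨le_rfl, one_pos⟩
  have hα' : α ∈ Icc (0 : ℝ) 1 := Ico_subset_Icc_self hα
  refine Subset.antisymm ?_ (union_subset (h.range_subset_image hlam hd ha hα' h0)
    (h.range_subset_image hlam hd ha hα' hα))
  rintro _ ⟨y, hy, rfl⟩
  obtain ⟨j, hj | hj⟩ := exists_phiFun_eq (lam := lam) (d := d) (δ := δ) hα' hq hρ y
  · rw [← zero_add ((j : ℝ) / q)] at hj
    obtain ⟨k, hk⟩ := h.exists_iterate_eq hlam hd ha hα' hq hpq hρ hy h0 hj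
    exact Or.inl ⟨k, hk.symm⟩
  · obtain ⟨k, hk⟩ := h.exists_iterate_eq hlam hd ha hα' hq hpq hρ hy hα hj
    exact Or.inr ⟨k, hk.symm⟩

/-- The orbit of φ(0) consists of values at points of ℤ/q. A jump at `α` or at the grid point
separates each of them from φ(α). -/
theorem orbits_ne (hlam : lam ∈ Ioo (0 : ℝ) 1) (hd : d ∈ Ioo (0 : ℝ) (1 - lam))
    (ha : a ∈ Icc (0 : ℝ) 1) (hα : α ∈ Icc (0 : ℝ) 1) (h : IsCompatible lam d δ a ρ α)
    {p q : ℕ} (hq : 0 < q) (hpq : Nat.Coprime p q) (hρ : q * ρ = p) (hαq : ∀ j : ℤ, q * α ≠ j) :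
    (range fun n : ℕ => (pcMap lam d δ a)^[n] (phiFun lam d δ ρ α 0)) ≠
      range fun n : ℕ => (pcMap lam d δ a)^[n] (phiFun lam d δ ρ α α) := by
  intro heq
  have hq' : (0 : ℝ) < q := by exact_mod_cast hq
  have hmem : phiFun lam d δ ρ α α ∈
      range fun n : ℕ => (pcMap lam d δ a)^[n] (phiFun lam d δ ρ α 0) := heq ▸ ⟨0, rfl⟩
  obtain ⟨n, hn⟩ := hmem
  simp only at hn
  rw [h.iterate_pcMap_phiFun hlam hd ha hα, iterate_rotMap ⟨le_rfl, one_pos⟩, zero_add] at hn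
  have hw : Int.fract (n * ρ) = ((n * p - q * ⌊n * ρ⌋ : ℤ) : ℝ) / q := by
    rw [eq_div_iff hq'.ne', ← Int.self_sub_floor]
    push_cast
    rw [← hρ]; ring
  rw [hw] at hn
  rcases lt_trichotomy (((n * p - q * ⌊n * ρ⌋ : ℤ) : ℝ) / q) α with h1 | h1 | h1
  -- The jump at α comes from k = q, as α - qρ = α - p.
  · refine hn.not_lt (phiFun_lt_phiFun hlam hd hα h1 le_rfl ⟨q, -p, hq, Or.inr ?_⟩)
    rw [hρ]; push_cast; ring
  · apply hαq (n * p - q * ⌊n * ρ⌋ : ℤ)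
    rw [← h1, mul_div_cancel₀ _ hq'.ne']
  · exact hn.not_gt (phiFun_lt_phiFun_of_div hlam hd hα hq hpq hρ h1 le_rfl)

end IsCompatible

theorem range_iterate_iterate {X : Type*} {g : X → X} {q : ℕ} (hq : 0 < q) {z : X}
    (hz : Function.IsPeriodicPt g q z) (k : ℕ) :
    (range fun n : ℕ => g^[n] (g^[k] z)) = range fun n : ℕ => g^[n] z := by
  refine Subset.antisymm ?_ ?_
  · rintro _ ⟨n, rfl⟩
    exact ⟨n + k, Function.iterate_add_apply g n k z⟩
  · rintro _ ⟨n, rfl⟩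
    -- Stepping back k times is stepping forward k(q - 1) times.
    refine ⟨n + k * (q - 1), ?_⟩
    have e : n + k * (q - 1) + k = n + k * q := by
      obtain ⟨r, rfl⟩ := Nat.exists_eq_add_of_lt hq
      simp; ring
    simp only
    rw [← Function.iterate_add_apply, e, Function.iterate_add_apply, (hz.const_mul k).eq]

theorem periodicPt_mem_attractor {x : ℝ} (hx : x ∈ Ico (0 : ℝ) 1) {q : ℕ} (hq : 0 < q)
    (hper : Function.IsPeriodicPt (pcMap lam d δ a) q x) : x ∈ attractor lam d δ a := by
  refine mem_iInter.2 fun n => ⟨(pcMap lam d δ a)^[n * (q - 1)] x, ?_, ?_⟩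
  · cases n * (q - 1) with
    | zero => exact hx
    | succ k =>
      rw [Function.iterate_succ_apply']
      exact pcMap_mem _
  · have e : n + n * (q - 1) = n * q := by
      obtain ⟨r, rfl⟩ := Nat.exists_eq_add_of_lt hq
      simp; ring
    rw [← Function.iterate_add_apply, e, (hper.const_mul n).eq]

/-- Every periodic point lies in the attractor, hence in the image of φ, hence on one of the two
known orbits. -/
theorem IsCompatible.isPeriodicOrbit_iff (hlam : lam ∈ Ioo (0 : ℝ) 1)
    (hd : d ∈ Ioo (0 : ℝ) (1 - lam)) (ha : a ∈ Icc (0 : ℝ) 1) (hα : α ∈ Ico (0 : ℝ) 1)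
    (h : IsCompatible lam d δ a ρ α) {p q : ℕ} (hq : 0 < q) (hpq : Nat.Coprime p q)
    (hρ : q * ρ = p) (hαq : ∀ j : ℤ, q * α ≠ j) (P : Set ℝ) :
    IsPeriodicOrbit (pcMap lam d δ a) q P ↔
      (P = range fun n : ℕ => (pcMap lam d δ a)^[n] (phiFun lam d δ ρ α 0)) ∨
        P = range fun n : ℕ => (pcMap lam d δ a)^[n] (phiFun lam d δ ρ α α) := by
  have h0 : (0 : ℝ) ∈ Ico (0 : ℝ) 1 := ⟨le_rfl, one_pos⟩
  have hα' : α ∈ Icc (0 : ℝ) 1 := Ico_subset_Icc_self hα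
  constructor
  · rintro ⟨-, x, hx, hxq, rfl⟩
    have hper : Function.IsPeriodicPt (pcMap lam d δ a) q x :=
      hxq ▸ Function.isPeriodicPt_minimalPeriod _ _
    have hmem := h.attractor_subset_of_rational hlam hd ha hα' hq hpq hρ hαq
      (periodicPt_mem_attractor hx hq hper)
    rw [h.image_eq_union hlam hd ha hα hq hpq hρ] at hmem
    rcases hmem with ⟨k, rfl⟩ | ⟨k, rfl⟩
    · exact Or.inl (range_iterate_iterate hq (h.iterate_period hlam hd ha hα' hρ h0) k)
    · exact Or.inr (range_iterate_iterate hq (h.iterate_period hlam hd ha hα' hρ hα) k)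
  · rintro (rfl | rfl)
    · exact h.isPeriodicOrbit_range hlam hd ha hα' hq hpq hρ h0
    · exact h.isPeriodicOrbit_range hlam hd ha hα' hq hpq hρ hα

/-! ### The irrational case -/

theorem preperfect_image_phiFun (hlam : lam ∈ Ioo (0 : ℝ) 1) (hd : d ∈ Ioo (0 : ℝ) (1 - lam))
    (hα : α ∈ Icc (0 : ℝ) 1) (hρ : Irrational ρ) :
    Preperfect (phiFun lam d δ ρ α '' Ico 0 1) := by
  rintro _ ⟨y, hy, rfl⟩
  rw [accPt_iff_frequently]
  have h1 : Tendsto (phiFun lam d δ ρ α) (𝓝[>] y) (𝓝 (phiFun lam d δ ρ α y)) :=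
    (tendsto_phiFun_nhdsGE hlam hd hα y).mono_left (nhdsWithin_mono _ Ioi_subset_Ici_self)
  refine h1.frequently (Eventually.frequently ?_)
  filter_upwards [Ioo_mem_nhdsGT hy.2] with z hz
  exact ⟨(phiFun_strictMono hlam hd hα hρ hz.1).ne',
    mem_image_of_mem _ ⟨hy.1.trans hz.1.le, hz.2⟩⟩

/-- An interval in the closure would contain two values of φ; a jump of φ between their arguments
leaves a gap without values. -/
theorem isTotallyDisconnected_closure_image (hlam : lam ∈ Ioo (0 : ℝ) 1)
    (hd : d ∈ Ioo (0 : ℝ) (1 - lam)) (hα : α ∈ Icc (0 : ℝ) 1) (hρ : Irrational ρ) :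
    IsTotallyDisconnected (closure (phiFun lam d δ ρ α '' Ico 0 1)) := by
  have hmono := phiFun_strictMono (δ := δ) hlam hd hα hρ
  have key : ∀ u v : ℝ, u < v → ¬ Icc u v ⊆ closure (phiFun lam d δ ρ α '' Ico 0 1) := by
    intro u v huv hsub
    have hpt : ∀ b c : ℝ, u ≤ b → b < c → c ≤ v → ∃ y, phiFun lam d δ ρ α y ∈ Ioo b c := by
      intro b c hb hbc hc
      have h1 : (b + c) / 2 ∈ closure (phiFun lam d δ ρ α '' Ico 0 1) :=
        hsub ⟨by linarith, by linarith⟩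
      obtain ⟨_, hx, y, -, rfl⟩ := mem_closure_iff.1 h1 (Ioo b c) isOpen_Ioo
        ⟨by linarith, by linarith⟩
      exact ⟨y, hx⟩
    obtain ⟨y₁, h1⟩ := hpt u v le_rfl huv le_rfl
    obtain ⟨y₂, h2⟩ := hpt _ v h1.1.le h1.2 le_rfl
    obtain ⟨k, m, hk, hy⟩ := hρ.exists_nat_mul_mem_Ioo (hmono.lt_iff_lt.1 h2.1)
    have hjump := phiLeft_lt_phiFun (δ := δ) hlam hd hα (ρ := ρ) (y := m + k * ρ)
      ⟨k, m, hk, Or.inl (by ring)⟩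
    have h3 := phiFun_le_phiLeft (δ := δ) (ρ := ρ) hlam hd hα hy.1
    have h4 := hmono hy.2
    obtain ⟨z, hz⟩ := hpt _ _ (h1.1.le.trans h3) hjump (h4.le.trans h2.2.le)
    rcases lt_or_ge z (m + k * ρ) with hzy | hzy
    · exact (phiFun_le_phiLeft hlam hd hα hzy).not_gt hz.1
    · exact (hmono.monotone hzy).not_gt hz.2
  intro t hts ht x hx y hy
  by_contra hne
  rcases lt_or_gt_of_ne hne with h | h
  · exact key x y h ((ht.ordConnected.out hx hy).trans hts)
  · exact key y x h ((ht.ordConnected.out hy hx).trans hts)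

theorem IsCompatible.isCantorSet_closure_image (hlam : lam ∈ Ioo (0 : ℝ) 1)
    (hd : d ∈ Ioo (0 : ℝ) (1 - lam)) (hα : α ∈ Icc (0 : ℝ) 1) (h : IsCompatible lam d δ a ρ α)
    (hρ : Irrational ρ) : IsCantorSet (closure (phiFun lam d δ ρ α '' Ico 0 1)) := by
  refine ⟨((nonempty_Ico.2 one_pos).image _).closure, ?_,
    (preperfect_image_phiFun hlam hd hα hρ).perfect_closure,
    isTotallyDisconnected_closure_image hlam hd hα hρ⟩
  refine (isCompact_Icc (a := (0 : ℝ)) (b := 1)).of_isClosed_subset isClosed_closure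
    (closure_minimal ?_ isClosed_Icc)
  rintro _ ⟨y, hy, rfl⟩
  exact Ico_subset_Icc_self ((h.phiFun_mem_iff hlam hd hα).2 hy)

/-! ### Assembly -/

theorem theorem5 (lam d δ a ρ α : ℝ)
    (hlam : lam ∈ Ioo (0 : ℝ) 1) (hd : d ∈ Ioo (0 : ℝ) (1 - lam))
    (hδ : δ ∈ Ioo (1 - lam - d) 1) (ha : a ∈ Icc (0 : ℝ) 1)
    (hρ : ρ ∈ Ioo (0 : ℝ) 1) (hα : α ∈ Icc (0 : ℝ) 1) :
    List.TFAE [IntervalConditions lam d δ a ρ α,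
      ConjugacyCondition lam d δ a ρ α,
      CodingCondition lam d δ a ρ α] ∧
    ((IntervalConditions lam d δ a ρ α ∨ ConjugacyCondition lam d δ a ρ α ∨
        CodingCondition lam d δ a ρ α) →
      phiFun lam d δ ρ α '' Ico 0 1 ⊆ attractor lam d δ a ∧
      (∀ p q : ℕ, 0 < p → p < q → Nat.Coprime p q → ρ = (p : ℝ) / (q : ℝ) →
        ((∃ i : ℕ, i ≤ q ∧ α = (i : ℝ) / (q : ℝ)) →
          IsPeriodicOrbit (pcMap lam d δ a) q (phiFun lam d δ ρ α '' Ico 0 1)) ∧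
        ((¬ ∃ i : ℕ, i ≤ q ∧ α = (i : ℝ) / (q : ℝ)) →
          phiFun lam d δ ρ α '' Ico 0 1 = attractor lam d δ a ∧
          ∃ P₁ P₂ : Set ℝ, P₁ ≠ P₂ ∧
            (∀ P : Set ℝ, IsPeriodicOrbit (pcMap lam d δ a) q P ↔ P = P₁ ∨ P = P₂) ∧
            phiFun lam d δ ρ α '' Ico 0 1 = P₁ ∪ P₂)) ∧
      (Irrational ρ →
        phiFun lam d δ ρ α '' Ico 0 1 = attractor lam d δ a ∧
        IsCantorSet (closure (attractor lam d δ a)))) := by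
  rw [codingCondition_iff hlam hd hδ ha hρ hα, conjugacyCondition_iff hlam hd ha hα,
    intervalConditions_iff hlam hd hα, or_self, or_self]
  refine ⟨by tfae_have 1 ↔ 2 := Iff.rfl
             tfae_have 2 ↔ 3 := Iff.rfl
             tfae_finish, fun h => ⟨h.image_subset_attractor hlam hd ha hα, ?_, fun hirr => ?_⟩⟩
  · intro p q _ hpq' hpq hρq
    have hq : 0 < q := by omega
    have hq' : (0 : ℝ) < q := by exact_mod_cast hq
    have hρ' : q * ρ = p := by rw [hρq, mul_div_cancel₀ _ hq'.ne']
    refine ⟨h.image_isPeriodicOrbit hlam hd ha hα hq hpq hρ', fun hne => ?_⟩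
    -- For α in [0,1] an integer qα lies between 0 and q; in particular α = 1 is excluded, so α can
    -- serve as a starting point of an orbit.
    have hαq : ∀ j : ℤ, q * α ≠ j := by
      intro j hj
      have h1 : (0 : ℝ) ≤ j := hj ▸ mul_nonneg hq'.le hα.1
      have h2 : (j : ℝ) ≤ q := hj ▸ mul_le_of_le_one_right hq'.le hα.2
      norm_cast at h1 h2
      obtain ⟨i, rfl⟩ := Int.eq_ofNat_of_zero_le h1
      exact hne ⟨i, by exact_mod_cast h2, by
        rw [eq_div_iff hq'.ne', mul_comm]; exact_mod_cast hj⟩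
    have hα' : α ∈ Ico (0 : ℝ) 1 := by
      refine ⟨hα.1, hα.2.lt_of_ne ?_⟩
      rintro rfl
      exact hαq q (by simp)
    exact ⟨(h.image_subset_attractor hlam hd ha hα).antisymm
      (h.attractor_subset_of_rational hlam hd ha hα hq hpq hρ' hαq), _, _,
      h.orbits_ne hlam hd ha hα hq hpq hρ' hαq,
      h.isPeriodicOrbit_iff hlam hd ha hα' hq hpq hρ' hαq,
      h.image_eq_union hlam hd ha hα' hq hpq hρ'⟩
  · have heq := (h.image_subset_attractor hlam hd ha hα).antisymm
      (h.attractor_subset_of_irrational hlam hd ha hα hirr)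
    exact ⟨heq, heq ▸ h.isCantorSet_closure_image hlam hd hα hirr⟩
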